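/- Let $\Omega\subset\mathbb R^2$ be the open region bounded by a convex polygon $\Gamma$ with outer unit normal $\mathbf n$. For $\delta>0$ put $\Omega^-=\{x\in\Omega: B_\delta(x)\subset\Omega\}$, $\Omega_\gamma^-=\Omega\setminus\overline{\Omega^-}$, $\Omega^+=\mathbb R^2\setminus\overline{\{x: B_\delta(x)\cap\Omega=\emptyset\}}$, $\Omega_\gamma^+=\Omega^+\setminus\overline\Omega$. A kernel with horizon $\delta$ and second moment $\sigma$ is a function $\gamma_\delta(x,y)=\widetilde\gamma_\delta(|x-y|)\ge 0$ with $\widetilde\gamma_\delta\in L^1(0,\delta)$, $\widetilde\gamma_\delta(r)=0$ for $r>\delta$, and $\frac{\pi}{2}\int_0^\delta r^3\,\widetilde\gamma_\delta(r)\,dr=\sigma$. The three nonlocal Neumann operators are $$\mathcal N_\Omega^-u(x)=-\int_{\Omega_\gamma^+}[u(x)-u(y)]\gamma_\delta(x,y)\,dy\quad (x\in\Omega_\gamma^-),$$ $$\mathcal N_\Omega^+u(x)=\int_{\Omega_\gamma^-}[u(x)-u(y)]\gamma_\delta(x,y)\,dy\quad (x\in\Omega_\gamma^+),$$ $$\mathcal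 N_\Omega^*u(x)=\int_{\Omega^+}[u(x)-u(y)]\gamma_\delta(x,y)\,dy\quad (x\in\Omega_\gamma^+).$$ Let $\mathcal N_\Omega$ be any one of them, let $D_\delta$ be the set on which it is defined ($\Omega_\gamma^-$ for $\mathcal N_\Omega^-$, $\Omega_\gamma^+$ for $\mathcal N_\Omega^+$ and $\mathcal N_\Omega^*$), and let $S_N(\Omega)$ be the set of functions $u$ with $\sup_{x\in D_\delta}|\mathcal N_\Omega u(x)|<\infty$. Theorem. Let $\sigma\in\mathbb R$, and let $u,v:\mathbb R^2\to\mathbb R$ be such that $u$ is $C^2$ and $v$ is $C^1$ on an open neighbourhood of $\Gamma$. Then there are constants $C$ and $\delta_0>0$, which depend only on $\Omega$, $\sigma$, $u$, $v$ and the choice of operator, such that for every $0<\delta<\delta_0$ and every kernel $\gamma_\delta$ with horizon $\delta$ and second moment $\sigma$ for which $u\in S_N(\Omega)$, the double integral in $(\mathcal N_\Omega u,v)_{D_\delta}=\int_{D_\delta}\mathcal N_\Omega u(x)\,v(x)\,dx$ converges absolutely and $$\Big|(\mathcal N_\Omega u,v)_{D_\delta}-\int_\Gamma\sigma\,\partial_{\mathbf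 n}u\,v\,ds\Big|\le C\,\delta .$$ In other words, $(\mathcal N_\Omega u,v)_{D_\delta}=\langle\sigma\partial_{\mathbf n}u,v\rangle_\Gamma+\mathcal O(\delta)$ as $\delta\to0$. -/

import Mathlib

open MeasureTheory Set

noncomputable section

namespace NonlocalNeumann

/-- The Euclidean plane. -/
abbrev Plane : Type := EuclideanSpace ℝ (Fin 2)

/-! ### Convex polygons -/

/-- The planar cross product. -/
def cross (a b : Plane) : ℝ := a 0 * b 1 - a 1 * b 0

/-- The vertices are those of a strictly convex polygon, listed counterclockwise: there are at
least three of them, and each vertex lies strictly to the left of every directed edge that does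
not contain it. Every convex polygon in the plane has such a list of vertices. -/
def IsConvexCCW {n : ℕ} (P : Polygon Plane n) : Prop :=
  3 ≤ n ∧ ∀ i j : Fin n, j ≠ i → j ≠ finRotate n i →
    0 < cross (P (finRotate n i) - P i) (P j - P i)

/-- The open region bounded by a convex polygon. -/
def region {n : ℕ} (P : Polygon Plane n) : Set Plane :=
  interior (convexHull ℝ (range P.vertices))

/-- The length of the `i`-th edge. -/
def edgeLength {n : ℕ} (P : Polygon Plane n) (i : Fin n) : ℝ :=
  dist (P i) (P (finRotate n i))

/-- The outer unit normal on the `i`-th edge of a counterclockwise convex polygon: the unit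
direction of the edge, turned clockwise by a right angle. -/
def outerNormal {n : ℕ} (P : Polygon Plane n) (i : Fin n) : Plane :=
  (edgeLength P i)⁻¹ •
    !₂[P (finRotate n i) 1 - P i 1, -(P (finRotate n i) 0 - P i 0)]

/-- `⟨σ ∂ₙu, v⟩_Γ`, the integral of `σ ∂ₙu v` with respect to arc length over the boundary of the
polygon, as the sum of the integrals over the edges. -/
def boundaryPairing {n : ℕ} (P : Polygon Plane n) (σ : ℝ) (u v : Plane → ℝ) : ℝ :=
  ∑ i : Fin n, ∫ t in (0 : ℝ)..1,
    σ * fderiv ℝ u (P.edgePath ℝ i t) (outerNormal P i) * v (P.edgePath ℝ i t) * edgeLength P i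

/-! ### The sets attached to a domain and a horizon -/

/-- `Ω⁻`. -/
def innerSet (Ω : Set Plane) (δ : ℝ) : Set Plane := {x ∈ Ω | Metric.ball x δ ⊆ Ω}

/-- `Ω_γ⁻ = Ω ∖ closure Ω⁻`. -/
def innerStrip (Ω : Set Plane) (δ : ℝ) : Set Plane := Ω \ closure (innerSet Ω δ)

/-- `Ω⁺`. -/
def outerSet (Ω : Set Plane) (δ : ℝ) : Set Plane :=
  (closure {x : Plane | Metric.ball x δ ∩ Ω = ∅})ᶜ

/-- `Ω_γ⁺ = Ω⁺ ∖ closure Ω`. -/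
def outerStrip (Ω : Set Plane) (δ : ℝ) : Set Plane := outerSet Ω δ \ closure Ω

/-! ### Kernels -/

/-- `g` is the radial profile of a kernel `γ_δ(x, y) = g (|x - y|)` on the plane with horizon `δ`
and second moment `σ`. -/
structure IsKernelProfile (σ δ : ℝ) (g : ℝ → ℝ) : Prop where
  horizon_pos : 0 < δ
  integrable : IntegrableOn g (Ioo 0 δ)
  nonneg : ∀ r, 0 ≤ r → 0 ≤ g r
  eq_zero : ∀ r, δ < r → g r = 0
  second_moment : Real.pi / 2 * ∫ r in Ioo 0 δ, r ^ 3 * g r = σ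

/-! ### The three nonlocal Neumann operators -/

/-- Names for the operators `N⁻`, `N⁺` and `N*`. -/
inductive NeumannKind : Type
  | minus
  | plus
  | star

/-- The set on which the operator is defined: `Ω_γ⁻` for `N⁻` and `Ω_γ⁺` for `N⁺` and `N*`. -/
def opDomain (k : NeumannKind) (Ω : Set Plane) (δ : ℝ) : Set Plane :=
  match k with
  | .minus => innerStrip Ω δ
  | .plus => outerStrip Ω δ
  | .star => outerStrip Ω δ

/-- The set over which the operator integrates: `Ω_γ⁺` for `N⁻`, `Ω_γ⁻` for `N⁺` and `Ω⁺`
for `N*`. -/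
def opRange (k : NeumannKind) (Ω : Set Plane) (δ : ℝ) : Set Plane :=
  match k with
  | .minus => outerStrip Ω δ
  | .plus => innerStrip Ω δ
  | .star => outerSet Ω δ

/-- The sign in front of the integral. -/
def opSign (k : NeumannKind) : ℝ :=
  match k with
  | .minus => -1
  | .plus => 1
  | .star => 1

/-- The nonlocal Neumann operator
`N u (x) = ± ∫ (u x - u y) γ_δ(x, y) dy`. -/
def neumannOp (k : NeumannKind) (Ω : Set Plane) (δ : ℝ) (g : ℝ → ℝ) (u : Plane → ℝ)
    (x : Plane) : ℝ :=
  opSign k * ∫ y in opRange k Ω δ, (u x - u y) * g (dist x y)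

/-- The space `S_N(Ω)`: the function `N u` is bounded where it is defined. -/
def MemSN (k : NeumannKind) (Ω : Set Plane) (δ : ℝ) (g : ℝ → ℝ) (u : Plane → ℝ) : Prop :=
  ∃ M : ℝ, ∀ x ∈ opDomain k Ω δ, |neumannOp k Ω δ g u x| ≤ M

/-- The pairing `(N u, v)` over the set where `N u` is defined. -/
def neumannPairing (k : NeumannKind) (Ω : Set Plane) (δ : ℝ) (g : ℝ → ℝ) (u v : Plane → ℝ) : ℝ :=
  ∫ x in opDomain k Ω δ, neumannOp k Ω δ g u x * v x

/-- The double integral in the pairing `(N u, v)` converges absolutely. -/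
def PairingConverges (k : NeumannKind) (Ω : Set Plane) (δ : ℝ) (g : ℝ → ℝ)
    (u v : Plane → ℝ) : Prop :=
  Integrable (fun z : Plane × Plane => (u z.1 - u z.2) * g (dist z.1 z.2) * v z.1)
    ((volume.restrict (opDomain k Ω δ)).prod (volume.restrict (opRange k Ω δ)))

end NonlocalNeumann

end

/-! Only values near `Γ` enter, so a cutoff makes `u` and `v` globally `C²` and `C¹` with compact
support. Each pairing is then an integral of some `Φ (x, y)` against `k (y - x)`, with `k` even.

Since the kernel reaches only to distance `δ`, the pairings for `N⁺` and `N⁻` (swap `x` and `y` in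
the latter) both integrate over `x` in the outer strip and `y ∈ Ω`, the integrand being `u x - u y`
times `v x`, respectively `v y`. Replacing that factor by `(v x + v y) / 2` costs half a product of
two differences, which is `O(|x - y|²)`. The second moment of `k` is bounded and the strip has area
`O(δ)`, so the cost is `O(δ)`. `N*` adds the interaction of the outer strip with itself, which by
antisymmetry also reduces to such a product (`kernelPairing_outerStrip`). All three operators thus
share one symmetric main term (`kernelPairing_symm`).

In the main term put `y = x + z`. For fixed `z` the integral in `x` equals `∫_Ω (G x - G (x - z))`
with `G` the function `symmDiffProd u v z`. The divergence theorem turns it into a sum over edges of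
`n · z` times averages of `G (p - s z)`, `p` on the edge and `s ∈ [0, 1]`
(`integral_region_sub_translate`). There `G = ∂_z u(p) v(p) / 2 + O(|z|²)`. Integrating against `k`,
isotropy gives `∫ (n · z) ∂_z u k = 2 σ ∂ₙu`, hence exactly `⟨σ ∂ₙu, v⟩_Γ`. The remainder is
controlled by the third moment, at most `4 σ δ`.

The divergence theorem on the polygon is itself proved by integrating by parts against a smoothed
product of half-plane indicators and letting the smoothing width tend to zero. -/

namespace NonlocalNeumann

/-! ### Half-plane description of a convex polygon -/

/-- The signed distance of `x` to the line through the `i`-th edge, positive outside. -/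
noncomputable def sideFun {n : ℕ} (P : Polygon Plane n) (i : Fin n) (x : Plane) : ℝ :=
  inner ℝ (outerNormal P i) (x - P i)

/-- The unit direction of the `i`-th edge. -/
noncomputable def edgeDir {n : ℕ} (P : Polygon Plane n) (i : Fin n) : Plane :=
  (edgeLength P i)⁻¹ • (P (finRotate n i) - P i)

lemma inner_plane (a b : Plane) : inner ℝ a b = a 0 * b 0 + a 1 * b 1 := by
  simp [PiLp.inner_apply, Fin.sum_univ_two, mul_comm]

lemma norm_sq_plane (a : Plane) : ‖a‖ ^ 2 = a 0 ^ 2 + a 1 ^ 2 := by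
  rw [← real_inner_self_eq_norm_sq, inner_plane]; ring

lemma finRotate_ne {n : ℕ} (hn : 3 ≤ n) (i : Fin n) : finRotate n i ≠ i := by
  obtain ⟨m, rfl⟩ := Nat.exists_eq_add_of_le' hn
  rw [finRotate_apply]
  simp

lemma finRotate_finRotate_ne {n : ℕ} (hn : 3 ≤ n) (i : Fin n) :
    finRotate n (finRotate n i) ≠ i := by
  obtain ⟨m, rfl⟩ := Nat.exists_eq_add_of_le' hn
  rw [finRotate_apply, finRotate_apply]
  intro h
  have h2 : (1 : Fin (m + 3)) + 1 = 0 := by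
    have := congrArg (fun t => t - i) h
    simpa [add_assoc, add_sub_cancel_left] using this
  have := congrArg Fin.val h2
  rw [Fin.val_add] at this
  simp at this
  rw [Nat.mod_eq_of_lt (by omega)] at this
  omega

section Geometry

variable {n : ℕ} {P : Polygon Plane n}

lemma IsConvexCCW.edgeLength_pos (hP : IsConvexCCW P) (i : Fin n) : 0 < edgeLength P i := by
  rw [edgeLength, dist_pos]
  intro h
  have := hP.2 i (finRotate n (finRotate n i)) (finRotate_finRotate_ne hP.1 i)
    (finRotate_ne hP.1 _)
  rw [← h] at this
  simp [cross] at this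

lemma edgeLength_sq (i : Fin n) : edgeLength P i ^ 2 =
    (P (finRotate n i) 0 - P i 0) ^ 2 + (P (finRotate n i) 1 - P i 1) ^ 2 := by
  rw [edgeLength, dist_comm, dist_eq_norm, norm_sq_plane]; simp

lemma IsConvexCCW.norm_outerNormal (hP : IsConvexCCW P) (i : Fin n) :
    ‖outerNormal P i‖ = 1 := by
  have h := hP.edgeLength_pos i
  have : ‖outerNormal P i‖ ^ 2 = 1 := by
    rw [norm_sq_plane, outerNormal]
    have := edgeLength_sq (P := P) i
    simp [-finRotate_apply]
    field_simp
    linarith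
  nlinarith [norm_nonneg (outerNormal P i)]

lemma edgeDir_zero (i : Fin n) : edgeDir P i 0 = -outerNormal P i 1 := by
  simp [edgeDir, outerNormal, -finRotate_apply]
  ring

lemma edgeDir_one (i : Fin n) : edgeDir P i 1 = outerNormal P i 0 := by
  simp [edgeDir, outerNormal, -finRotate_apply]

lemma IsConvexCCW.edgeLength_smul_edgeDir (hP : IsConvexCCW P) (i : Fin n) :
    edgeLength P i • edgeDir P i = P (finRotate n i) - P i := by
  rw [edgeDir, smul_inv_smul₀ (hP.edgeLength_pos i).ne']

lemma IsConvexCCW.normal_sq (hP : IsConvexCCW P) (i : Fin n) :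
    outerNormal P i 0 ^ 2 + outerNormal P i 1 ^ 2 = 1 := by
  rw [← norm_sq_plane, hP.norm_outerNormal i, one_pow]

lemma IsConvexCCW.edgeLength_mul_sideFun (hP : IsConvexCCW P) (i : Fin n) (x : Plane) :
    edgeLength P i * sideFun P i x = -cross (P (finRotate n i) - P i) (x - P i) := by
  have h := hP.edgeLength_pos i
  rw [sideFun, inner_plane, outerNormal, cross]
  simp
  field_simp
  ring

/-- Coordinates adapted to the `i`-th edge. -/
noncomputable def edgePoint (P : Polygon Plane n) (i : Fin n) (a b : ℝ) : Plane :=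
  P i + a • edgeDir P i + b • outerNormal P i

lemma IsConvexCCW.sideFun_edgePoint (hP : IsConvexCCW P) (i : Fin n) (a b : ℝ) :
    sideFun P i (edgePoint P i a b) = b := by
  have h := hP.normal_sq i
  rw [sideFun, edgePoint, inner_plane]
  simp [edgeDir_zero, edgeDir_one]
  linear_combination b * h

lemma sideFun_edgePoint_affine (i j : Fin n) (a b : ℝ) :
    sideFun P j (edgePoint P i a b) = sideFun P j (P i) + a * inner ℝ (outerNormal P j) (edgeDir P i)
      + b * inner ℝ (outerNormal P j) (outerNormal P i) := by
  simp only [sideFun, edgePoint, inner_plane]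
  simp
  ring

lemma IsConvexCCW.exists_edgePoint (hP : IsConvexCCW P) (i : Fin n) (x : Plane) :
    ∃ a, x = edgePoint P i a (sideFun P i x) := by
  have h := hP.normal_sq i
  refine ⟨inner ℝ (edgeDir P i) (x - P i), ?_⟩
  simp only [sideFun, edgePoint, inner_plane]
  ext k
  fin_cases k <;> simp [edgeDir_zero, edgeDir_one]
  · linear_combination (P i 0 - x 0) * h
  · linear_combination (P i 1 - x 1) * h

lemma IsConvexCCW.edgePoint_edgeLength (hP : IsConvexCCW P) (i : Fin n) :
    edgePoint P i (edgeLength P i) 0 = P (finRotate n i) := by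
  rw [edgePoint, hP.edgeLength_smul_edgeDir]; simp

lemma sideFun_self (i : Fin n) : sideFun P i (P i) = 0 := by simp [sideFun]

lemma IsConvexCCW.sideFun_succ (hP : IsConvexCCW P) (i : Fin n) :
    sideFun P i (P (finRotate n i)) = 0 := by
  rw [← hP.edgePoint_edgeLength, hP.sideFun_edgePoint]

lemma IsConvexCCW.sideFun_vertex_neg (hP : IsConvexCCW P) {i j : Fin n} (h1 : j ≠ i)
    (h2 : j ≠ finRotate n i) : sideFun P i (P j) < 0 := by
  have h := hP.2 i j h1 h2
  have h3 := hP.edgeLength_mul_sideFun i (P j)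
  have := hP.edgeLength_pos i
  by_contra! hc
  nlinarith [mul_nonneg this.le hc]

lemma IsConvexCCW.sideFun_vertex_nonpos (hP : IsConvexCCW P) (i j : Fin n) :
    sideFun P i (P j) ≤ 0 := by
  by_cases h1 : j = i
  · rw [h1, sideFun_self]
  by_cases h2 : j = finRotate n i
  · rw [h2, hP.sideFun_succ]
  exact (hP.sideFun_vertex_neg h1 h2).le

lemma continuous_sideFun (i : Fin n) : Continuous (sideFun P i) := by
  unfold sideFun; fun_prop

/-- An affine function that is nonpositive at both ends of an edge and negative at one of them is
negative between them. Two distinct sides of the polygon cannot share both end points. -/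
lemma IsConvexCCW.sideFun_edge_neg (hP : IsConvexCCW P) {i j : Fin n} (hij : j ≠ i) {a : ℝ}
    (ha : 0 < a) (ha' : a < edgeLength P i) : sideFun P j (edgePoint P i a 0) < 0 := by
  have h0 := hP.sideFun_vertex_nonpos j i
  have h1 := hP.sideFun_vertex_nonpos j (finRotate n i)
  have e1 := sideFun_edgePoint_affine (P := P) i j (edgeLength P i) 0
  have ea := sideFun_edgePoint_affine (P := P) i j a 0
  rw [hP.edgePoint_edgeLength] at e1
  have key : sideFun P j (P i) < 0 ∨ sideFun P j (P (finRotate n i)) < 0 := by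
    by_cases h : i = finRotate n j
    · right
      refine hP.sideFun_vertex_neg ?_ ?_
      · rw [h]; exact finRotate_finRotate_ne hP.1 j
      · intro h'; exact hij ((finRotate n).injective h').symm
    · left; exact hP.sideFun_vertex_neg hij.symm h
  have hl := hP.edgeLength_pos i
  have : edgeLength P i * sideFun P j (edgePoint P i a 0) =
      (edgeLength P i - a) * sideFun P j (P i) + a * sideFun P j (P (finRotate n i)) := by
    rw [ea, e1]; ring
  by_contra! hc
  have h5 := mul_nonneg hl.le hc
  rcases key with k | k
  · nlinarith [mul_pos (sub_pos.2 ha') (neg_pos.2 k), mul_nonneg ha.le (neg_nonneg.2 h1)]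
  · nlinarith [mul_pos ha (neg_pos.2 k), mul_nonneg (sub_pos.2 ha').le (neg_nonneg.2 h0)]

/-- The preceding side is the witness: its affine function vanishes at `P i` and is negative at the
next vertex, so it is positive on the backward extension of the edge. -/
lemma IsConvexCCW.exists_sideFun_pos_of_neg (hP : IsConvexCCW P) (i : Fin n) {a : ℝ}
    (ha : a < 0) : ∃ j, j ≠ i ∧ 0 < sideFun P j (edgePoint P i a 0) := by
  obtain ⟨j, hj⟩ := (finRotate n).surjective i
  have hji : j ≠ i := by rw [← hj]; exact (finRotate_ne hP.1 j).symm
  refine ⟨j, hji, ?_⟩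
  have e1 := sideFun_edgePoint_affine (P := P) i j (edgeLength P i) 0
  have ea := sideFun_edgePoint_affine (P := P) i j a 0
  rw [hP.edgePoint_edgeLength] at e1
  have h0 : sideFun P j (P i) = 0 := by rw [← hj, hP.sideFun_succ]
  have h1 : sideFun P j (P (finRotate n i)) < 0 := by
    refine hP.sideFun_vertex_neg ?_ ?_
    · rw [← hj]; exact finRotate_finRotate_ne hP.1 j
    · rw [hj]; exact finRotate_ne hP.1 i
  have hl := hP.edgeLength_pos i
  rw [h0] at e1 ea
  rw [e1] at h1
  rw [ea]
  have : inner ℝ (outerNormal P j) (edgeDir P i) < 0 := by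
    by_contra! hc
    nlinarith [mul_nonneg hl.le hc]
  nlinarith

/-- Mirror image of the previous lemma, with the following side as witness. -/
lemma IsConvexCCW.exists_sideFun_pos_of_gt (hP : IsConvexCCW P) (i : Fin n) {a : ℝ}
    (ha : edgeLength P i < a) : ∃ j, j ≠ i ∧ 0 < sideFun P j (edgePoint P i a 0) := by
  refine ⟨finRotate n i, finRotate_ne hP.1 i, ?_⟩
  set j := finRotate n i with hj
  have e1 := sideFun_edgePoint_affine (P := P) i j (edgeLength P i) 0
  have ea := sideFun_edgePoint_affine (P := P) i j a 0
  rw [hP.edgePoint_edgeLength, ← hj, sideFun_self] at e1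
  have h1 : sideFun P j (P i) < 0 :=
    hP.sideFun_vertex_neg (finRotate_ne hP.1 i).symm (finRotate_finRotate_ne hP.1 i).symm
  have hl := hP.edgeLength_pos i
  have : 0 < inner ℝ (outerNormal P j) (edgeDir P i) := by
    by_contra! hc
    nlinarith [mul_nonneg hl.le (neg_nonneg.2 hc)]
  rw [ea]
  nlinarith

lemma edgePath_eq (hP : IsConvexCCW P) (i : Fin n) (t : ℝ) :
    P.edgePath ℝ i t = edgePoint P i (edgeLength P i * t) 0 := by
  rw [Polygon.edgePath, AffineMap.lineMap_apply, edgePoint, mul_comm, mul_smul,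
    hP.edgeLength_smul_edgeDir]
  simp [add_comm]

lemma IsConvexCCW.mem_boundary (hP : IsConvexCCW P) {x : Plane} (hx : ∀ j, sideFun P j x ≤ 0)
    {i : Fin n} (hi : sideFun P i x = 0) : x ∈ P.boundary ℝ := by
  obtain ⟨a, ha⟩ := hP.exists_edgePoint i x
  rw [hi] at ha
  have hl := hP.edgeLength_pos i
  have h0 : 0 ≤ a := by
    by_contra! hc
    obtain ⟨j, -, hj⟩ := hP.exists_sideFun_pos_of_neg i hc
    rw [← ha] at hj
    exact (hx j).not_gt hj
  have h1 : a ≤ edgeLength P i := by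
    by_contra! hc
    obtain ⟨j, -, hj⟩ := hP.exists_sideFun_pos_of_gt i hc
    rw [← ha] at hj
    exact (hx j).not_gt hj
  rw [Polygon.boundary, mem_iUnion]
  refine ⟨i, ?_⟩
  rw [Polygon.edgeSet_eq_image_edgePath]
  refine ⟨a / edgeLength P i, ⟨by positivity, (div_le_one hl).2 h1⟩, ?_⟩
  rw [edgePath_eq hP, ha]
  congr 1
  field_simp

lemma convex_sideFun_nonpos : Convex ℝ {x | ∀ i, sideFun P i x ≤ 0} := by
  rw [ofPred_forall]
  refine convex_iInter fun i => ?_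
  intro x hx y hy a b ha hb hab
  simp only [mem_ofPred_eq] at *
  have : sideFun P i (a • x + b • y) = a * sideFun P i x + b * sideFun P i y := by
    simp only [sideFun, inner_plane]
    simp
    linear_combination (-outerNormal P i 0 * P i 0 - outerNormal P i 1 * P i 1) * (-hab)
  rw [this]
  nlinarith [mul_nonneg ha (neg_nonneg.2 hx), mul_nonneg hb (neg_nonneg.2 hy)]

lemma isOpen_sideFun_neg : IsOpen {x | ∀ i, sideFun P i x < 0} := by
  rw [ofPred_forall]
  exact isOpen_iInter_of_finite fun i => isOpen_lt (continuous_sideFun i) continuous_const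

/-- Otherwise a functional separates `x` from the hull. At a vertex where it is maximal it is
nonpositive along both adjacent edges, yet `x` lies in the cone these edges span. -/
lemma IsConvexCCW.sideFun_neg_subset_hull (hP : IsConvexCCW P) :
    {x | ∀ i, sideFun P i x < 0} ⊆ convexHull ℝ (range P.vertices) := by
  intro x hx
  by_contra hc
  obtain ⟨f, c, hf, hcx⟩ := geometric_hahn_banach_closed_point (convex_convexHull ℝ _)
    ((finite_range P.vertices).isClosed_convexHull (𝕜 := ℝ)) hc
  have : Nonempty (Fin n) := ⟨⟨0, by have := hP.1; omega⟩⟩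
  obtain ⟨j, hj⟩ := Finite.exists_max (fun i => f (P i))
  have hfx : f (P j) < f x := (hf _ (subset_convexHull ℝ _ ⟨j, rfl⟩)).trans hcx
  obtain ⟨m, hm⟩ := (finRotate n).surjective j
  have c1 := hP.2 j m (by rw [← hm]; exact (finRotate_ne hP.1 m).symm)
    (by rw [← hm]; exact (finRotate_finRotate_ne hP.1 m).symm)
  have hs : ∀ i, 0 < cross (P (finRotate n i) - P i) (x - P i) := fun i => by
    have := hP.edgeLength_mul_sideFun i x
    have := mul_neg_of_pos_of_neg (hP.edgeLength_pos i) (hx i)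
    linarith
  have c2 := hs j
  have c3 := hs m
  rw [hm] at c3
  set p := P (finRotate n j) - P j with hp
  set q := P m - P j with hq
  set w := x - P j with hw
  have hpf : f p ≤ 0 := by rw [hp, map_sub]; linarith [hj (finRotate n j)]
  have hqf : f q ≤ 0 := by rw [hq, map_sub]; linarith [hj m]
  have hwf : 0 < f w := by rw [hw, map_sub]; linarith
  have c4 : 0 < cross w q := by
    have : cross w q = cross (P j - P m) (x - P m) := by
      rw [hw, hq]; simp [cross]; ring
    rw [this]; exact c3
  -- Cramer's rule for `w` in the basis `p`, `q`; all three coefficients are positive.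
  have e : cross p q • w = cross w q • p + cross p w • q := by
    ext k
    fin_cases k <;> simp [cross] <;> ring
  have := congrArg f e
  simp only [map_smul, map_add, smul_eq_mul] at this
  nlinarith [mul_pos c1 hwf, mul_nonneg c4.le (neg_nonneg.2 hpf),
    mul_nonneg c2.le (neg_nonneg.2 hqf)]

lemma IsConvexCCW.hull_subset (hP : IsConvexCCW P) :
    convexHull ℝ (range P.vertices) ⊆ {x | ∀ i, sideFun P i x ≤ 0} := by
  refine convexHull_min ?_ convex_sideFun_nonpos
  rintro _ ⟨j, rfl⟩ i
  exact hP.sideFun_vertex_nonpos i j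

lemma IsConvexCCW.region_eq (hP : IsConvexCCW P) :
    region P = {x | ∀ i, sideFun P i x < 0} := by
  apply Subset.antisymm
  · intro x hx i
    have hx' := interior_mono hP.hull_subset hx
    obtain ⟨ε, hε, hb⟩ := Metric.mem_nhds_iff.1 (mem_interior_iff_mem_nhds.1 hx')
    -- An interior point can still be moved outwards, so its signed distance is strictly negative.
    have h1 : x + (ε / 2) • outerNormal P i ∈ Metric.ball x ε := by
      rw [Metric.mem_ball, dist_eq_norm, add_sub_cancel_left, norm_smul, hP.norm_outerNormal,
        Real.norm_eq_abs, abs_of_pos (by positivity)]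
      linarith
    have h2 := hb h1 i
    have h3 : sideFun P i (x + (ε / 2) • outerNormal P i) = sideFun P i x + ε / 2 := by
      have := hP.normal_sq i
      simp only [sideFun, inner_plane]
      simp
      linear_combination (ε / 2) * this
    linarith
  · exact interior_maximal hP.sideFun_neg_subset_hull isOpen_sideFun_neg

lemma isOpen_region : IsOpen (region P) := isOpen_interior

lemma convex_region : Convex ℝ (region P) := (convex_convexHull ℝ _).interior

lemma isBounded_region : Bornology.IsBounded (region P) :=
  ((isBounded_convexHull).2 (finite_range P.vertices).isBounded).subset interior_subset

/-- The average of the vertices works, because every side has a vertex strictly on its inner side.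
-/
lemma IsConvexCCW.region_nonempty (hP : IsConvexCCW P) : (region P).Nonempty := by
  have hn : 0 < (n : ℝ) := by exact_mod_cast (show 0 < n by have := hP.1; omega)
  refine ⟨∑ j, (n : ℝ)⁻¹ • P j, ?_⟩
  rw [hP.region_eq]
  intro i
  have : sideFun P i (∑ j, (n : ℝ)⁻¹ • P j) = ∑ j, (n : ℝ)⁻¹ * sideFun P i (P j) := by
    have h1 : ∑ j : Fin n, (n : ℝ)⁻¹ • P j - P i = ∑ j : Fin n, (n : ℝ)⁻¹ • (P j - P i) := by
      simp only [smul_sub, Finset.sum_sub_distrib]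
      congr 1
      rw [Finset.sum_const, Finset.card_univ, Fintype.card_fin, ← Nat.cast_smul_eq_nsmul ℝ,
        smul_inv_smul₀ hn.ne']
    simp only [sideFun, h1, inner_sum, inner_smul_right]
  rw [this]
  refine Finset.sum_neg' (fun j _ => mul_nonpos_of_nonneg_of_nonpos (by positivity)
    (hP.sideFun_vertex_nonpos i j)) ⟨finRotate n (finRotate n i), Finset.mem_univ _, ?_⟩
  exact mul_neg_of_pos_of_neg (by positivity)
    (hP.sideFun_vertex_neg (finRotate_finRotate_ne hP.1 i) (finRotate_ne hP.1 _))

lemma IsConvexCCW.frontier_subset (hP : IsConvexCCW P) :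
    frontier (region P) ⊆ P.boundary ℝ := by
  intro x hx
  have h1 : ∀ j, sideFun P j x ≤ 0 := by
    have hcl : IsClosed {x | ∀ i, sideFun P i x ≤ 0} := by
      rw [ofPred_forall]
      exact isClosed_iInter fun i => isClosed_le (continuous_sideFun i) continuous_const
    exact closure_minimal (interior_subset.trans hP.hull_subset) hcl (frontier_subset_closure hx)
  have h2 : x ∉ region P := by
    have := hx.2; rwa [isOpen_region.interior_eq] at this
  rw [hP.region_eq, mem_ofPred_eq] at h2
  push Not at h2
  obtain ⟨i, hi⟩ := h2
  exact hP.mem_boundary h1 (le_antisymm (h1 i) hi)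

end Geometry

/-! ### The strips around the boundary -/

/-- A set missing the frontier would be separated by the interiors of `Ω` and of its complement. -/
lemma _root_.IsPreconnected.inter_frontier_nonempty {X : Type*} [TopologicalSpace X] {s Ω : Set X}
    (hs : IsPreconnected s) {x y : X} (hxs : x ∈ s) (hys : y ∈ s) (hx : x ∈ Ω) (hy : y ∉ Ω) :
    (s ∩ frontier Ω).Nonempty := by
  by_contra hne
  have h : ∀ p ∈ s, p ∉ frontier Ω := fun p hp hf => hne ⟨p, hp, hf⟩
  have h1 : ∀ p ∈ s, p ∈ Ω → p ∈ interior Ω := fun p hp hΩ => by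
    by_contra hi
    exact h p hp ⟨subset_closure hΩ, hi⟩
  have h2 : ∀ p ∈ s, p ∉ Ω → p ∈ interior Ωᶜ := fun p hp hΩ => by
    by_contra hi
    refine h p hp ?_
    rw [← frontier_compl]
    exact ⟨subset_closure hΩ, hi⟩
  obtain ⟨p, -, hp1, hp2⟩ := hs (interior Ω) (interior Ωᶜ) isOpen_interior isOpen_interior
    (fun p hp => by
      by_cases hΩ : p ∈ Ω
      · exact Or.inl (h1 p hp hΩ)
      · exact Or.inr (h2 p hp hΩ)) ⟨x, hxs, h1 x hxs hx⟩ ⟨y, hys, h2 y hys hy⟩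
  exact interior_subset hp2 (interior_subset hp1)

section Strips

variable {Ω : Set Plane} {δ : ℝ}

lemma mem_innerStrip {x y : Plane} (hx : x ∈ Ω) (hy : y ∉ Ω) (hxy : dist x y < δ) :
    x ∈ innerStrip Ω δ := by
  refine ⟨hx, fun hc => ?_⟩
  obtain ⟨x', hx', hd⟩ := Metric.mem_closure_iff.1 hc (δ - dist x y) (by linarith)
  refine hy (hx'.2 ?_)
  rw [Metric.mem_ball]
  linarith [dist_triangle y x x', dist_comm x y]

lemma mem_outerSet {x y : Plane} (hx : x ∈ Ω) (hxy : dist x y < δ) : y ∈ outerSet Ω δ := by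
  intro hc
  obtain ⟨y', hy', hd⟩ := Metric.mem_closure_iff.1 hc (δ - dist x y) (by linarith)
  have : x ∈ Metric.ball y' δ ∩ Ω := by
    refine ⟨?_, hx⟩
    rw [Metric.mem_ball]
    linarith [dist_triangle x y y']
  rw [show Metric.ball y' δ ∩ Ω = ∅ from hy'] at this
  exact this

/-- The kernel may be nonzero at distance exactly `δ`, whereas the strips are defined with open
balls. Moving a point slightly within an open set bridges the gap. -/
lemma exists_dist_lt_of_dist_le {x y : Plane} (hδ : 0 < δ) (hxy : dist x y ≤ δ) {V : Set Plane}
    (hV : IsOpen V) (hx : x ∈ V) : ∃ x' ∈ V, dist x' y < δ := by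
  have hc : x ∈ closure (Metric.ball y δ) := by
    rw [closure_ball _ hδ.ne']; exact hxy
  obtain ⟨x', hx', hb⟩ := mem_closure_iff.1 hc V hV hx
  exact ⟨x', hx', hb⟩

lemma mem_innerStrip_of_le {x y : Plane} (hδ : 0 < δ) (hx : x ∈ Ω) (hy : y ∉ closure Ω)
    (hxy : dist x y ≤ δ) : x ∈ innerStrip Ω δ := by
  rw [dist_comm] at hxy
  obtain ⟨y', hy', hd⟩ := exists_dist_lt_of_dist_le hδ hxy isClosed_closure.isOpen_compl hy
  exact mem_innerStrip hx (fun h => hy' (subset_closure h)) (by rwa [dist_comm])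

lemma mem_outerStrip_of_le (ho : IsOpen Ω) {x y : Plane} (hδ : 0 < δ) (hx : x ∈ Ω)
    (hy : y ∉ closure Ω) (hxy : dist x y ≤ δ) : y ∈ outerStrip Ω δ := by
  obtain ⟨x', hx', hd⟩ := exists_dist_lt_of_dist_le hδ hxy ho hx
  exact ⟨mem_outerSet hx' hd, hy⟩

lemma exists_of_mem_outerSet {y : Plane} (hy : y ∈ outerSet Ω δ) : ∃ x ∈ Ω, dist x y < δ := by
  by_contra! hc
  refine hy (subset_closure ?_)
  rw [mem_ofPred_eq, eq_empty_iff_forall_notMem]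
  rintro x ⟨h1, h2⟩
  exact (hc x h2).not_gt h1

lemma exists_frontier_of_mem_innerStrip {x : Plane} (hx : x ∈ innerStrip Ω δ) (hδ : 0 < δ) :
    ∃ p ∈ frontier Ω, dist x p < δ := by
  have h : ¬ Metric.ball x δ ⊆ Ω := fun h => hx.2 (subset_closure ⟨hx.1, h⟩)
  obtain ⟨y, hy, hyΩ⟩ := not_subset.1 h
  obtain ⟨p, hp, hpf⟩ := (convex_ball x δ).isPreconnected.inter_frontier_nonempty
    (Metric.mem_ball_self hδ) hy hx.1 hyΩ
  exact ⟨p, hpf, by rw [dist_comm]; exact hp⟩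

lemma exists_frontier_of_mem_outerStrip {y : Plane} (hy : y ∈ outerStrip Ω δ) (hδ : 0 < δ) :
    ∃ p ∈ frontier Ω, dist y p < δ := by
  obtain ⟨x, hx, hxy⟩ := exists_of_mem_outerSet hy.1
  obtain ⟨p, hp, hpf⟩ := (convex_ball y δ).isPreconnected.inter_frontier_nonempty
    (show x ∈ _ from hxy) (Metric.mem_ball_self hδ) hx (fun h => hy.2 (subset_closure h))
  exact ⟨p, hpf, by rw [dist_comm]; exact hp⟩

lemma measurableSet_innerStrip (hΩ : IsOpen Ω) : MeasurableSet (innerStrip Ω δ) :=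
  hΩ.measurableSet.diff isClosed_closure.measurableSet

lemma measurableSet_outerSet : MeasurableSet (outerSet Ω δ) :=
  isClosed_closure.measurableSet.compl

lemma measurableSet_outerStrip : MeasurableSet (outerStrip Ω δ) :=
  measurableSet_outerSet.diff isClosed_closure.measurableSet

lemma outerSet_subset_thickening : outerSet Ω δ ⊆ Metric.thickening δ Ω := by
  intro y hy
  obtain ⟨x, hx, hxy⟩ := exists_of_mem_outerSet hy
  rw [Metric.mem_thickening_iff]
  exact ⟨x, hx, by rwa [dist_comm]⟩

/-- If `y ∈ Ω` and `|x - y| < δ`, then `c + (r / δ) (x - y)` lies in the inscribed ball. The convex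
combination of it and `y` with weights proportional to `δ / r` and `1` is the preimage of `x`. -/
lemma outerSet_subset_homothety (hc : Convex ℝ Ω) {c : Plane} {r : ℝ} (hr : 0 < r)
    (hball : Metric.ball c r ⊆ Ω) (hδ : 0 < δ) :
    outerSet Ω δ ⊆ AffineMap.homothety c (1 + δ / r) '' Ω := by
  intro x hx
  obtain ⟨y, hy, hyx⟩ := exists_of_mem_outerSet hx
  have hq : 0 < 1 + δ / r := by positivity
  have hw : c + (r / δ) • (x - y) ∈ Ω := by
    apply hball
    rw [Metric.mem_ball, dist_eq_norm, add_sub_cancel_left, norm_smul, ← dist_eq_norm,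
      Real.norm_eq_abs, abs_of_pos (by positivity), dist_comm, div_mul_eq_mul_div, div_lt_iff₀ hδ]
    exact mul_lt_mul_of_pos_left hyx hr
  have hmem := hc hy hw (a := (1 + δ / r)⁻¹) (b := (1 + δ / r)⁻¹ * (δ / r)) (by positivity)
    (by positivity) (by field_simp)
  refine ⟨_, hmem, ?_⟩
  rw [AffineMap.homothety_apply]
  simp only [vsub_eq_sub, vadd_eq_add]
  ext i
  simp
  field_simp
  ring

/-- The area of the outer strip of a bounded open convex set is of the order of its width. -/
lemma exists_volume_outerStrip_le (ho : IsOpen Ω) (hc : Convex ℝ Ω) (hb : Bornology.IsBounded Ω)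
    (hne : Ω.Nonempty) :
    ∃ A, 0 ≤ A ∧ ∀ δ, 0 < δ → δ ≤ 1 → volume.real (outerStrip Ω δ) ≤ A * δ := by
  obtain ⟨c, hcΩ⟩ := hne
  obtain ⟨r, hr, hball⟩ := Metric.isOpen_iff.1 ho c hcΩ
  have hfin : volume Ω ≠ ⊤ := hb.measure_lt_top.ne
  refine ⟨(2 / r + 1 / r ^ 2) * volume.real Ω, by positivity, fun δ hδ hδ1 => ?_⟩
  -- The strip and `Ω` fit disjointly into a dilate of area `(1 + δ / r)²` times that of `Ω`; `δ ≤
  -- 1` then makes the excess linear in `δ`.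
  have hsub : Ω ∪ outerStrip Ω δ ⊆ AffineMap.homothety c (1 + δ / r) '' Ω := by
    refine union_subset (fun x hx => ?_) (sdiff_subset.trans ?_)
    · exact outerSet_subset_homothety hc hr hball hδ (mem_outerSet hx (by simpa))
    · exact outerSet_subset_homothety hc hr hball hδ
  have hfinI : volume (AffineMap.homothety c (1 + δ / r) '' Ω) ≠ ⊤ := by
    rw [Measure.addHaar_image_homothety]
    exact ENNReal.mul_ne_top ENNReal.ofReal_ne_top hfin
  have h1 := measureReal_mono hsub hfinI
  have hdisj : Disjoint Ω (outerStrip Ω δ) :=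
    disjoint_left.2 fun x hx hx' => hx'.2 (subset_closure hx)
  have hfs : volume (outerStrip Ω δ) ≠ ⊤ :=
    ne_top_of_le_ne_top hfinI (measure_mono (subset_union_right.trans hsub))
  rw [measureReal_union hdisj measurableSet_outerStrip hfin hfs] at h1
  have h2 : volume.real (AffineMap.homothety c (1 + δ / r) '' Ω) =
      (1 + δ / r) ^ 2 * volume.real Ω := by
    rw [Measure.real, Measure.addHaar_image_homothety, ENNReal.toReal_mul,
      ENNReal.toReal_ofReal (abs_nonneg _), finrank_euclideanSpace_fin,
      abs_of_nonneg (by positivity), Measure.real]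
  rw [h2] at h1
  have h3 : (1 + δ / r) ^ 2 - 1 ≤ (2 / r + 1 / r ^ 2) * δ := by
    have : (1 + δ / r) ^ 2 - 1 = 2 / r * δ + 1 / r ^ 2 * (δ * δ) := by field_simp; ring
    rw [this, add_mul]
    gcongr
    nlinarith
  have h4 := mul_le_mul_of_nonneg_right h3 (measureReal_nonneg (μ := volume) (s := Ω))
  linarith

lemma isBounded_outerSet (hb : Bornology.IsBounded Ω) : Bornology.IsBounded (outerSet Ω δ) :=
  hb.thickening.subset outerSet_subset_thickening

end Strips

open Filter Topology

/-! ### Green's formula on a convex polygon -/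

/-! ### Orthonormal coordinates along an edge -/

section Coordinates

variable {n : ℕ} {P : Polygon Plane n}

lemma edgePoint_add (i : Fin n) (a b : ℝ) :
    edgePoint P i a b = P i + (a • edgeDir P i + b • outerNormal P i) := by
  rw [edgePoint, add_assoc]

lemma IsConvexCCW.norm_edgeFrame (hP : IsConvexCCW P) (i : Fin n) (a b : ℝ) :
    ‖a • edgeDir P i + b • outerNormal P i‖ ^ 2 = a ^ 2 + b ^ 2 := by
  have h := hP.normal_sq i
  rw [norm_sq_plane]
  simp [edgeDir_zero, edgeDir_one]
  linear_combination (a ^ 2 + b ^ 2) * h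

/-- The rotation taking the standard frame to the frame of the `i`-th edge. -/
noncomputable def IsConvexCCW.edgeFrame (hP : IsConvexCCW P) (i : Fin n) :
    Plane →ₗᵢ[ℝ] Plane where
  toFun v := v 0 • edgeDir P i + v 1 • outerNormal P i
  map_add' v w := by simp only [PiLp.add_apply]; module
  map_smul' c v := by
    simp only [PiLp.smul_apply, smul_eq_mul, RingHom.id_apply]; module
  norm_map' v := by
    have h := hP.norm_edgeFrame i (v 0) (v 1)
    rw [← norm_sq_plane] at h
    exact (sq_eq_sq₀ (norm_nonneg _) (norm_nonneg _)).1 h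

lemma continuous_edgePoint (i : Fin n) :
    Continuous fun q : ℝ × ℝ => edgePoint P i q.1 q.2 := by
  unfold edgePoint; fun_prop

lemma IsConvexCCW.measurePreserving_edgePoint (hP : IsConvexCCW P) (i : Fin n) :
    MeasurePreserving (fun q : ℝ × ℝ => edgePoint P i q.1 q.2) := by
  let L := (hP.edgeFrame i).toLinearIsometryEquiv rfl
  have h1 : MeasurePreserving L := L.measurePreserving
  have h2 := (PiLp.volume_preserving_toLp (Fin 2)).comp
    ((volume_preserving_finTwoArrow ℝ).symm MeasurableEquiv.finTwoArrow)
  have h3 : MeasurePreserving (fun x : Plane => P i + x) :=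
    measurePreserving_add_left volume (P i)
  have h4 := h3.comp (h1.comp h2)
  convert h4 using 1
  funext q
  rw [edgePoint_add]
  rfl

lemma IsConvexCCW.edgePoint_injective (hP : IsConvexCCW P) (i : Fin n) :
    Function.Injective fun q : ℝ × ℝ => edgePoint P i q.1 q.2 := by
  rintro ⟨a, b⟩ ⟨a', b'⟩ h
  simp only [edgePoint_add, add_right_inj] at h
  have h2 := hP.norm_edgeFrame i (a - a') (b - b')
  rw [show (a - a') • edgeDir P i + (b - b') • outerNormal P i = 0 by
    rw [← sub_eq_zero] at h; rw [← h]; module] at h2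
  simp only [norm_zero] at h2
  have ha : a - a' = 0 := by nlinarith [sq_nonneg (a - a'), sq_nonneg (b - b')]
  have hb : b - b' = 0 := by nlinarith [sq_nonneg (a - a'), sq_nonneg (b - b')]
  simp [sub_eq_zero.1 ha, sub_eq_zero.1 hb]

lemma IsConvexCCW.measurableEmbedding_edgePoint (hP : IsConvexCCW P) (i : Fin n) :
    MeasurableEmbedding fun q : ℝ × ℝ => edgePoint P i q.1 q.2 :=
  (continuous_edgePoint i).measurableEmbedding (hP.edgePoint_injective i)

lemma IsConvexCCW.integral_edgePoint (hP : IsConvexCCW P) (i : Fin n) {F : Plane → ℝ}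
    (hF : Integrable F) : ∫ x, F x = ∫ a, ∫ b, F (edgePoint P i a b) := by
  rw [← (hP.measurePreserving_edgePoint i).integral_comp (hP.measurableEmbedding_edgePoint i)]
  rw [Measure.volume_eq_prod]
  exact integral_prod _ (((hP.measurePreserving_edgePoint i).integrable_comp_emb
    (hP.measurableEmbedding_edgePoint i)).2 hF)

lemma IsConvexCCW.abs_le_norm_edgePoint (hP : IsConvexCCW P) (i : Fin n) (a b : ℝ) :
    |a| ≤ ‖edgePoint P i a b‖ + ‖P i‖ := by
  have h := hP.norm_edgeFrame i a b
  have h1 : |a| ≤ ‖a • edgeDir P i + b • outerNormal P i‖ :=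
    abs_le_of_sq_le_sq (by nlinarith [sq_nonneg b]) (norm_nonneg _)
  rw [edgePoint_add]
  have h2 := norm_add_le (P i + (a • edgeDir P i + b • outerNormal P i)) (-P i)
  rw [norm_neg, add_neg_cancel_comm] at h2
  linarith

end Coordinates

/-! ### Smoothed indicators of intersections of half-planes -/

section Smoothing

open Real (smoothTransition)

lemma contDiff_smoothTransition : ContDiff ℝ 1 smoothTransition :=
  Real.smoothTransition.contDiff

lemma continuous_deriv_smoothTransition : Continuous (deriv smoothTransition) :=
  contDiff_smoothTransition.continuous_deriv le_rfl

lemma deriv_smoothTransition_of_notMem {x : ℝ} (hx : x ∉ Icc (0 : ℝ) 1) :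
    deriv smoothTransition x = 0 := by
  rw [mem_Icc, not_and_or, not_le, not_le] at hx
  rcases hx with hx | hx
  · have : smoothTransition =ᶠ[𝓝 x] fun _ => 0 := by
      filter_upwards [Iio_mem_nhds hx] with y hy
      exact Real.smoothTransition.zero_of_nonpos (le_of_lt hy)
    rw [this.deriv_eq]; simp
  · have : smoothTransition =ᶠ[𝓝 x] fun _ => 1 := by
      filter_upwards [Ioi_mem_nhds hx] with y hy
      exact Real.smoothTransition.one_of_one_le (le_of_lt hy)
    rw [this.deriv_eq]; simp

lemma hasCompactSupport_deriv_smoothTransition : HasCompactSupport (deriv smoothTransition) :=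
  HasCompactSupport.intro isCompact_Icc fun _ hx => deriv_smoothTransition_of_notMem hx

lemma integrable_deriv_smoothTransition : Integrable (deriv smoothTransition) :=
  continuous_deriv_smoothTransition.integrable_of_hasCompactSupport
    hasCompactSupport_deriv_smoothTransition

lemma integral_deriv_smoothTransition : ∫ t, deriv smoothTransition t = 1 := by
  rw [integral_of_hasDerivAt_of_tendsto (m := 0) (n := 1)
    (fun x => (contDiff_smoothTransition.differentiable one_ne_zero x).hasDerivAt)
    integrable_deriv_smoothTransition]
  · simp
  · refine tendsto_const_nhds.congr' ?_
    filter_upwards [eventually_le_atBot 0] with y hy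
    exact (Real.smoothTransition.zero_of_nonpos hy).symm
  · refine tendsto_const_nhds.congr' ?_
    filter_upwards [eventually_ge_atTop 1] with y hy
    exact (Real.smoothTransition.one_of_one_le hy).symm

variable {n : ℕ} {P : Polygon Plane n}

/-- A smooth approximation, as `N → ∞`, of the indicator of the intersection of the half-planes
of the edges in `s`. -/
noncomputable def smoothCut (P : Polygon Plane n) (s : Finset (Fin n)) (N : ℝ) (x : Plane) : ℝ :=
  ∏ j ∈ s, smoothTransition (-(N * sideFun P j x))

lemma contDiff_sideFun (i : Fin n) : ContDiff ℝ 1 (sideFun P i) := by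
  unfold sideFun
  exact contDiff_const.inner ℝ (contDiff_id.sub contDiff_const)

lemma hasFDerivAt_sideFun (i : Fin n) (x : Plane) :
    HasFDerivAt (sideFun P i) (innerSL ℝ (outerNormal P i)) x :=
  (innerSL ℝ (outerNormal P i)).hasFDerivAt.comp x ((hasFDerivAt_id x).sub_const (P i))

lemma contDiff_smoothCut (s : Finset (Fin n)) (N : ℝ) : ContDiff ℝ 1 (smoothCut P s N) := by
  unfold smoothCut
  exact contDiff_prod fun j _ => contDiff_smoothTransition.comp
    (contDiff_const.mul (contDiff_sideFun j)).neg

lemma smoothCut_nonneg (s : Finset (Fin n)) (N : ℝ) (x : Plane) : 0 ≤ smoothCut P s N x :=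
  Finset.prod_nonneg fun _ _ => Real.smoothTransition.nonneg _

lemma smoothCut_le_one (s : Finset (Fin n)) (N : ℝ) (x : Plane) : smoothCut P s N x ≤ 1 :=
  Finset.prod_le_one (fun _ _ => Real.smoothTransition.nonneg _)
    fun _ _ => Real.smoothTransition.le_one _

/-- The product rule isolates one edge per summand: the `i`-th term lives in a layer of width `1 /
N` along the `i`-th side, where it mimics a line measure. -/
lemma fderiv_smoothCut (N : ℝ) (x z : Plane) :
    fderiv ℝ (smoothCut P Finset.univ N) x z = -∑ i, inner ℝ (outerNormal P i) z *
      (N * (deriv smoothTransition (-(N * sideFun P i x)) *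
        smoothCut P (Finset.univ.erase i) N x)) := by
  have hi : ∀ i, HasFDerivAt (fun x => smoothTransition (-(N * sideFun P i x)))
      (deriv smoothTransition (-(N * sideFun P i x)) • -(N • innerSL ℝ (outerNormal P i))) x :=
    fun i => HasDerivAt.comp_hasFDerivAt (h₂ := smoothTransition)
      (f := fun y => -(N * sideFun P i y)) x
      (contDiff_smoothTransition.differentiable one_ne_zero _).hasDerivAt
      ((hasFDerivAt_sideFun i x).const_mul N).fun_neg
  have h : HasFDerivAt (smoothCut P Finset.univ N) _ x :=
    HasFDerivAt.finsetProd fun i _ => hi i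
  rw [h.fderiv, sum_apply, ← Finset.sum_neg_distrib]
  refine Finset.sum_congr rfl fun i _ => ?_
  simp [smoothCut]
  ring

end Smoothing

open Real (smoothTransition)

/-! ### The divergence theorem as a limit of integrations by parts -/

section Green

variable {n : ℕ} {P : Polygon Plane n}

lemma tendsto_smoothCut (x : Plane) :
    Tendsto (fun N => smoothCut P Finset.univ N x) atTop
      (𝓝 ({x | ∀ i, sideFun P i x < 0}.indicator 1 x)) := by
  by_cases hx : x ∈ {x | ∀ i, sideFun P i x < 0}
  · rw [indicator_of_mem hx, Pi.one_apply]
    refine tendsto_const_nhds.congr' ?_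
    have h : ∀ i, ∀ᶠ N : ℝ in atTop, 1 ≤ -(N * sideFun P i x) := fun i => by
      have := (tendsto_id (α := ℝ)).atTop_mul_const (neg_pos.2 (hx i))
      filter_upwards [this.eventually_ge_atTop 1] with N hN
      simpa using hN
    filter_upwards [eventually_all.2 h] with N hN
    rw [smoothCut, Finset.prod_eq_one fun j _ => Real.smoothTransition.one_of_one_le (hN j)]
  · rw [indicator_of_notMem hx]
    simp only [mem_ofPred_eq, not_forall, not_lt] at hx
    obtain ⟨i, hi⟩ := hx
    refine tendsto_const_nhds.congr' ?_
    filter_upwards [eventually_ge_atTop 0] with N hN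
    rw [smoothCut, Finset.prod_eq_zero (Finset.mem_univ i)]
    exact Real.smoothTransition.zero_of_nonpos (by nlinarith [mul_nonneg hN hi])

/-- At distance of order `1 / N` from the `i`-th side, the normal displacement changes the other
arguments `N * sideFun P j` by a bounded amount only. Away from the two vertices the value on the
line itself decides the limit. -/
lemma IsConvexCCW.tendsto_smoothCut_edge (hP : IsConvexCCW P) (i : Fin n) {a : ℝ} (ha : a ≠ 0)
    (ha' : a ≠ edgeLength P i) (τ : ℝ) :
    Tendsto (fun N => smoothCut P (Finset.univ.erase i) N (edgePoint P i a (-τ / N))) atTop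
      (𝓝 ((Ioc 0 (edgeLength P i)).indicator 1 a)) := by
  have key : ∀ j, ∀ N : ℝ, 0 < N → N * sideFun P j (edgePoint P i a (-τ / N)) =
      N * sideFun P j (edgePoint P i a 0) - τ * inner ℝ (outerNormal P j) (outerNormal P i) := by
    intro j N hN
    rw [sideFun_edgePoint_affine, sideFun_edgePoint_affine i j a 0]
    field_simp
    ring
  by_cases hx : a ∈ Ioc 0 (edgeLength P i)
  · rw [indicator_of_mem hx, Pi.one_apply]
    refine tendsto_const_nhds.congr' ?_
    have h : ∀ j, j ≠ i → ∀ᶠ N : ℝ in atTop,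
        1 ≤ -(N * sideFun P j (edgePoint P i a (-τ / N))) := fun j hj => by
      have hneg := hP.sideFun_edge_neg hj hx.1 (lt_of_le_of_ne hx.2 ha')
      have := (tendsto_id (α := ℝ)).atTop_mul_const (neg_pos.2 hneg)
      filter_upwards [this.eventually_ge_atTop
        (1 - τ * inner ℝ (outerNormal P j) (outerNormal P i)), eventually_gt_atTop 0] with N hN hN0
      rw [key j N hN0]
      simp only [id] at hN
      linarith
    have h' : ∀ᶠ N : ℝ in atTop, ∀ j, j ≠ i →
        1 ≤ -(N * sideFun P j (edgePoint P i a (-τ / N))) := by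
      rw [eventually_all]
      intro j
      by_cases hj : j = i
      · simp [hj]
      · simpa [hj] using h j hj
    filter_upwards [h'] with N hN
    rw [smoothCut, Finset.prod_eq_one fun j hj =>
      Real.smoothTransition.one_of_one_le (hN j (Finset.ne_of_mem_erase hj))]
  · rw [indicator_of_notMem hx]
    obtain ⟨j, hj, hpos⟩ : ∃ j, j ≠ i ∧ 0 < sideFun P j (edgePoint P i a 0) := by
      rw [mem_Ioc, not_and_or, not_lt, not_le] at hx
      rcases hx with hx | hx
      · exact hP.exists_sideFun_pos_of_neg i (lt_of_le_of_ne hx ha)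
      · exact hP.exists_sideFun_pos_of_gt i hx
    refine tendsto_const_nhds.congr' ?_
    have := (tendsto_id (α := ℝ)).atTop_mul_const hpos
    filter_upwards [this.eventually_ge_atTop
        (τ * inner ℝ (outerNormal P j) (outerNormal P i)), eventually_gt_atTop 0] with N hN hN0
    rw [smoothCut, Finset.prod_eq_zero (Finset.mem_erase.2 ⟨hj, Finset.mem_univ j⟩)]
    refine Real.smoothTransition.zero_of_nonpos ?_
    rw [key j N hN0]
    simp only [id] at hN
    linarith

lemma integrable_smoothCut_mul (s : Finset (Fin n)) {f : Plane → ℝ} (hf : Continuous f)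
    (hc : HasCompactSupport f) (i : Fin n) (N : ℝ) :
    Integrable fun x => N * (deriv smoothTransition (-(N * sideFun P i x)) *
      smoothCut P s N x) * f x := by
  refine Continuous.integrable_of_hasCompactSupport ?_ hc.mul_left
  have h1 := continuous_deriv_smoothTransition
  have h2 := continuous_sideFun (P := P) i
  have h3 := (contDiff_smoothCut (P := P) s N).continuous
  fun_prop

/-- Substitute `τ = -N b` in the normal coordinate; the Jacobian absorbs the factor `N`. -/
lemma IsConvexCCW.integral_smoothCut_edge (hP : IsConvexCCW P) {f : Plane → ℝ}
    (hf : Continuous f) (hc : HasCompactSupport f) (i : Fin n) {N : ℝ} (hN : 0 < N) :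
    ∫ x, N * (deriv smoothTransition (-(N * sideFun P i x)) *
      smoothCut P (Finset.univ.erase i) N x) * f x =
    ∫ a, ∫ τ, deriv smoothTransition τ *
      smoothCut P (Finset.univ.erase i) N (edgePoint P i a (-τ / N)) *
        f (edgePoint P i a (-τ / N)) := by
  rw [hP.integral_edgePoint i (integrable_smoothCut_mul _ hf hc i N)]
  congr 1
  funext a
  set g : ℝ → ℝ := fun τ => deriv smoothTransition τ *
      smoothCut P (Finset.univ.erase i) N (edgePoint P i a (-τ / N)) *
        f (edgePoint P i a (-τ / N)) with hg
  have h := Measure.integral_comp_mul_left g (-N)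
  rw [abs_inv, abs_neg, abs_of_pos hN, smul_eq_mul, eq_inv_mul_iff_mul_eq₀ hN.ne',
    ← integral_const_mul] at h
  rw [← h]
  congr 1
  funext b
  simp only [hg, hP.sideFun_edgePoint]
  have e : -(-N * b) / N = b := by field_simp
  rw [e, neg_mul]
  ring

/-- Dominated convergence in the rescaled coordinates. The limit factors into the edge integral and
`∫ deriv smoothTransition = 1`. -/
lemma IsConvexCCW.tendsto_integral_smoothCut_edge (hP : IsConvexCCW P) {f : Plane → ℝ}
    (hf : Continuous f) (hc : HasCompactSupport f) (i : Fin n) :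
    Tendsto (fun N : ℝ => ∫ x, N * (deriv smoothTransition (-(N * sideFun P i x)) *
      smoothCut P (Finset.univ.erase i) N x) * f x) atTop
      (𝓝 (edgeLength P i * ∫ t in (0 : ℝ)..1, f (P.edgePath ℝ i t))) := by
  obtain ⟨M, hM⟩ := hf.bounded_above_of_compact_support hc
  obtain ⟨R, hR⟩ := hc.isCompact.isBounded.exists_norm_le
  have hM0 : 0 ≤ M := (norm_nonneg _).trans (hM 0)
  have hfR : ∀ a b, ‖f (edgePoint P i a b)‖ ≤
      (Icc (-(R + ‖P i‖)) (R + ‖P i‖)).indicator (fun _ => M) a := by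
    intro a b
    by_cases h0 : f (edgePoint P i a b) = 0
    · rw [h0, norm_zero]; exact indicator_nonneg (fun _ _ => hM0) _
    · rw [indicator_of_mem]
      · exact hM _
      · rw [mem_Icc, ← abs_le]
        have := hR _ (subset_tsupport f h0)
        linarith [hP.abs_le_norm_edgePoint i a b]
  set F : ℝ → ℝ × ℝ → ℝ := fun N q => deriv smoothTransition q.2 *
      smoothCut P (Finset.univ.erase i) N (edgePoint P i q.1 (-q.2 / N)) *
        f (edgePoint P i q.1 (-q.2 / N)) with hF
  -- Dominating function: compact support of `f` bounds the tangential coordinate uniformly in `N`.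
  set B : ℝ × ℝ → ℝ := fun q => (Icc (-(R + ‖P i‖)) (R + ‖P i‖)).indicator (fun _ => M) q.1 *
    ‖deriv smoothTransition q.2‖ with hB
  have hBi : Integrable B (volume.prod volume) := by
    refine Integrable.mul_prod ?_ integrable_deriv_smoothTransition.norm
    rw [integrable_indicator_iff measurableSet_Icc]
    exact integrableOn_const (by simp) (by simp)
  have hFc : ∀ N, Continuous (F N) := by
    intro N
    have h1 := continuous_deriv_smoothTransition
    have h3 := (contDiff_smoothCut (P := P) (Finset.univ.erase i) N).continuous
    have h4 : Continuous fun q : ℝ × ℝ => edgePoint P i q.1 (-q.2 / N) :=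
      (continuous_edgePoint i).comp (by fun_prop : Continuous fun q : ℝ × ℝ => (q.1, -q.2 / N))
    have h5 := h3.comp h4
    have h6 := hf.comp h4
    exact ((h1.comp continuous_snd).mul h5).mul h6
  have hFB : ∀ N q, ‖F N q‖ ≤ B q := by
    intro N q
    simp only [hF, hB]
    rw [norm_mul, norm_mul, Real.norm_of_nonneg (smoothCut_nonneg _ _ _)]
    rw [mul_comm (indicator _ _ _)]
    refine mul_le_mul ?_ (hfR _ _) (norm_nonneg _) (norm_nonneg _)
    exact mul_le_of_le_one_right (norm_nonneg _) (smoothCut_le_one _ _ _)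
  have hFi : ∀ N, Integrable (F N) (volume.prod volume) := fun N =>
    hBi.mono' (hFc N).aestronglyMeasurable (Eventually.of_forall (hFB N))
  have hlim : Tendsto (fun N => ∫ q, F N q ∂(volume.prod volume)) atTop
      (𝓝 (∫ q : ℝ × ℝ, ((Ioc 0 (edgeLength P i)).indicator (fun a => f (edgePoint P i a 0)) q.1) *
        deriv smoothTransition q.2 ∂(volume.prod volume))) := by
    refine tendsto_integral_filter_of_dominated_convergence B
      (Eventually.of_forall fun N => (hFc N).aestronglyMeasurable)
      (Eventually.of_forall fun N => Eventually.of_forall (hFB N)) hBi ?_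
    -- The vertices, where the pointwise limit is not controlled, form a null set.
    have hae : ∀ᵐ q : ℝ × ℝ ∂(volume.prod volume), q.1 ∉ ({0, edgeLength P i} : Set ℝ) :=
      Measure.quasiMeasurePreserving_fst.ae
        ((Set.toFinite ({0, edgeLength P i} : Set ℝ)).countable.ae_notMem volume)
    filter_upwards [hae] with q hq
    simp only [mem_insert_iff, mem_singleton_iff, not_or] at hq
    have t1 := hP.tendsto_smoothCut_edge i hq.1 hq.2 q.2
    have t2 : Tendsto (fun N : ℝ => f (edgePoint P i q.1 (-q.2 / N))) atTop
        (𝓝 (f (edgePoint P i q.1 0))) := by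
      have h4 : Continuous fun b : ℝ => f (edgePoint P i q.1 b) :=
        hf.comp ((continuous_edgePoint i).comp (by fun_prop : Continuous fun b : ℝ => (q.1, b)))
      exact (h4.tendsto 0).comp (tendsto_const_nhds.div_atTop tendsto_id)
    have t3 := (t1.const_mul (deriv smoothTransition q.2)).mul t2
    convert t3 using 2
    by_cases hm : q.1 ∈ Ioc 0 (edgeLength P i)
    · rw [indicator_of_mem hm, indicator_of_mem hm]; simp; ring
    · rw [indicator_of_notMem hm, indicator_of_notMem hm]; simp
  have hval : ∫ q : ℝ × ℝ, ((Ioc 0 (edgeLength P i)).indicator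
      (fun a => f (edgePoint P i a 0)) q.1) * deriv smoothTransition q.2 ∂(volume.prod volume) =
      edgeLength P i * ∫ t in (0 : ℝ)..1, f (P.edgePath ℝ i t) := by
    rw [integral_prod_mul, integral_deriv_smoothTransition, mul_one,
      integral_indicator measurableSet_Ioc,
      ← intervalIntegral.integral_of_le (hP.edgeLength_pos i).le]
    simp_rw [edgePath_eq hP]
    rw [intervalIntegral.integral_comp_mul_left (fun a => f (edgePoint P i a 0))
      (hP.edgeLength_pos i).ne', smul_eq_mul, mul_inv_cancel_left₀ (hP.edgeLength_pos i).ne']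
    simp
  rw [hval] at hlim
  refine hlim.congr' ?_
  filter_upwards [eventually_gt_atTop 0] with N hN
  rw [hP.integral_smoothCut_edge hf hc i hN, integral_prod _ (hFi N)]

/-- The divergence theorem on a convex polygon, for the field `f z` with `z` constant. -/
theorem IsConvexCCW.integral_fderiv_region (hP : IsConvexCCW P) {f : Plane → ℝ}
    (hf : ContDiff ℝ 1 f) (hc : HasCompactSupport f) (z : Plane) :
    ∫ x in region P, fderiv ℝ f x z = ∑ i, inner ℝ (outerNormal P i) z *
      (edgeLength P i * ∫ t in (0 : ℝ)..1, f (P.edgePath ℝ i t)) := by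
  have hf' : Continuous fun x => fderiv ℝ f x z :=
    (hf.continuous_fderiv one_ne_zero).clm_apply continuous_const
  have hc' : HasCompactSupport fun x => fderiv ℝ f x z := hc.fderiv_apply ℝ z
  have hi' := hf'.integrable_of_hasCompactSupport (μ := volume) hc'
  have lim1 : Tendsto (fun N => ∫ x, smoothCut P Finset.univ N x * fderiv ℝ f x z) atTop
      (𝓝 (∫ x in region P, fderiv ℝ f x z)) := by
    rw [← integral_indicator isOpen_region.measurableSet]
    refine tendsto_integral_filter_of_dominated_convergence (fun x => ‖fderiv ℝ f x z‖)
      (Eventually.of_forall fun N =>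
        ((contDiff_smoothCut _ N).continuous.mul hf').aestronglyMeasurable)
      (Eventually.of_forall fun N => Eventually.of_forall fun x => ?_) hi'.norm
      (Eventually.of_forall fun x => ?_)
    · rw [norm_mul, Real.norm_of_nonneg (smoothCut_nonneg _ _ _)]
      exact mul_le_of_le_one_left (norm_nonneg _) (smoothCut_le_one _ _ _)
    · have := (tendsto_smoothCut (P := P) x).mul_const (fderiv ℝ f x z)
      rw [← hP.region_eq] at this
      convert this using 2
      by_cases hx : x ∈ region P
      · simp [hx]
      · simp [hx]
  have lim2 : Tendsto (fun N : ℝ => ∑ i, inner ℝ (outerNormal P i) z *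
      ∫ x, N * (deriv smoothTransition (-(N * sideFun P i x)) *
        smoothCut P (Finset.univ.erase i) N x) * f x) atTop
      (𝓝 (∑ i, inner ℝ (outerNormal P i) z *
        (edgeLength P i * ∫ t in (0 : ℝ)..1, f (P.edgePath ℝ i t)))) :=
    tendsto_finsetSum _ fun i _ =>
      (hP.tendsto_integral_smoothCut_edge hf.continuous hc i).const_mul _
  refine tendsto_nhds_unique (lim1.congr fun N => ?_) lim2
  have hφ := contDiff_smoothCut (P := P) Finset.univ N
  have hφ' : Continuous fun x => fderiv ℝ (smoothCut P Finset.univ N) x z :=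
    (hφ.continuous_fderiv one_ne_zero).clm_apply continuous_const
  -- Integration by parts moves the derivative onto the cutoff.
  rw [integral_mul_fderiv_eq_neg_fderiv_mul_of_integrable
    ((hφ'.mul hf.continuous).integrable_of_hasCompactSupport hc.mul_left)
    ((hφ.continuous.mul hf').integrable_of_hasCompactSupport hc'.mul_left)
    ((hφ.continuous.mul hf.continuous).integrable_of_hasCompactSupport hc.mul_left)
    (fun x _ => hφ.differentiable one_ne_zero x) (fun x _ => hf.differentiable one_ne_zero x),
    ← integral_neg]
  simp_rw [fderiv_smoothCut, neg_mul, neg_neg, Finset.sum_mul]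
  rw [integral_finsetSum _ fun i _ => ?_]
  · refine Finset.sum_congr rfl fun i _ => ?_
    rw [← integral_const_mul]
    congr 1
    funext x
    ring
  · have := (integrable_smoothCut_mul (P := P) (Finset.univ.erase i) hf.continuous hc i N).const_mul
      (inner ℝ (outerNormal P i) z)
    refine this.congr (Eventually.of_forall fun x => ?_)
    simp only
    ring

/-- The difference of the integrals of `G` over a polygon and over a translate of it, as an
integral over the strip swept by the boundary. -/
theorem IsConvexCCW.integral_region_sub_translate (hP : IsConvexCCW P) {G : Plane → ℝ}
    (hG : ContDiff ℝ 1 G) (hc : HasCompactSupport G) (z : Plane) :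
    ∫ x in region P, (G x - G (x - z)) = ∑ i, inner ℝ (outerNormal P i) z *
      (edgeLength P i * ∫ s in (0 : ℝ)..1, ∫ t in (0 : ℝ)..1,
        G (P.edgePath ℝ i t - s • z)) := by
  have hG' : Continuous (fderiv ℝ G) := hG.continuous_fderiv one_ne_zero
  have hcont : Continuous fun q : ℝ × Plane => fderiv ℝ G (q.2 - q.1 • z) z :=
    (hG'.comp (by fun_prop : Continuous fun q : ℝ × Plane => q.2 - q.1 • z)).clm_apply
      continuous_const
  -- Write the difference as an integral of derivatives along the segment, so that the divergence
  -- theorem applies to each translate.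
  have h1 : ∀ x, G x - G (x - z) = ∫ s in (0 : ℝ)..1, fderiv ℝ G (x - s • z) z := by
    intro x
    have hd : ∀ s ∈ uIcc (0 : ℝ) 1, HasDerivAt (fun s : ℝ => -G (x - s • z))
        (fderiv ℝ G (x - s • z) z) s := by
      intro s _
      have h2 : HasDerivAt (fun s : ℝ => x - s • z) (-z) s := by
        simpa using ((hasDerivAt_id s).smul_const z).const_sub x
      have h3 : HasDerivAt (fun s : ℝ => G (x - s • z)) (fderiv ℝ G (x - s • z) (-z)) s :=
        (hG.differentiable one_ne_zero (x - s • z)).hasFDerivAt.comp_hasDerivAt s h2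
      simpa using h3.fun_neg
    rw [intervalIntegral.integral_eq_sub_of_hasDerivAt hd
      ((hcont.comp (by fun_prop : Continuous fun s : ℝ => (s, x))).intervalIntegrable _ _)]
    simp
    ring
  simp_rw [h1]
  obtain ⟨M, hM⟩ := (hG'.clm_apply (continuous_const (y := z))).bounded_above_of_compact_support
    (hc.fderiv_apply ℝ z)
  have : IsFiniteMeasure (volume.restrict (region P)) :=
    ⟨by simpa using isBounded_region.measure_lt_top⟩
  have : IsFiniteMeasure (volume.restrict (uIoc (0 : ℝ) 1)) := by
    rw [uIoc_of_le zero_le_one]; infer_instance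
  have hint : Integrable (Function.uncurry fun (s : ℝ) x => fderiv ℝ G (x - s • z) z)
      ((volume.restrict (uIoc 0 1)).prod (volume.restrict (region P))) :=
    Integrable.of_bound hcont.aestronglyMeasurable M (Eventually.of_forall fun q => hM _)
  rw [← intervalIntegral_integral_swap hint]
  have h2 : ∀ s : ℝ, ∫ x in region P, fderiv ℝ G (x - s • z) z =
      ∑ i, inner ℝ (outerNormal P i) z *
      (edgeLength P i * ∫ t in (0 : ℝ)..1, G (P.edgePath ℝ i t - s • z)) := by
    intro s
    have := hP.integral_fderiv_region (f := fun x => G (x - s • z))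
      (hG.comp (contDiff_id.sub contDiff_const))
      (hc.comp_homeomorph (Homeomorph.subRight (s • z))) z
    simp_rw [fderiv_comp_sub] at this
    exact this
  simp_rw [h2]
  rw [intervalIntegral.integral_finsetSum]
  · simp_rw [intervalIntegral.integral_const_mul]
  · intro i _
    refine Continuous.intervalIntegrable ?_ _ _
    refine continuous_const.mul (continuous_const.mul ?_)
    refine intervalIntegral.continuous_parametric_intervalIntegral_of_continuous' ?_ _ _
    have he : Continuous (P.edgePath ℝ i) := (P.edgePath ℝ i).continuous_of_finiteDimensional
    exact hG.continuous.comp (by fun_prop)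

end Green

/-! ### Radial kernels on the plane -/

section Kernel

variable {σ δ : ℝ} {g : ℝ → ℝ}

lemma IsKernelProfile.integrableOn_pow (hg : IsKernelProfile σ δ g) (m : ℕ) :
    IntegrableOn (fun r => r ^ m * g r) (Ioi 0) := by
  have h1 : IntegrableOn (fun r => r ^ m * g r) (Ioo 0 δ) :=
    hg.integrable.continuousOn_mul_of_subset (K := Icc 0 δ) (by fun_prop) isCompact_Icc
      measurableSet_Ioo Ioo_subset_Icc_self
  have h2 : IntegrableOn (fun r => r ^ m * g r) (Ici δ) := by
    rw [integrableOn_Ici_iff_integrableOn_Ioi]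
    refine integrableOn_zero.congr_fun (fun r hr => ?_) measurableSet_Ioi
    rw [hg.eq_zero r hr, mul_zero]
  rw [← Ioo_union_Ici_eq_Ioi hg.horizon_pos]
  exact h1.union h2

lemma IsKernelProfile.integral_Ioi_pow (hg : IsKernelProfile σ δ g) (m : ℕ) :
    ∫ r in Ioi 0, r ^ m * g r = ∫ r in Ioo 0 δ, r ^ m * g r := by
  rw [← Ioo_union_Ici_eq_Ioi hg.horizon_pos, setIntegral_union _ measurableSet_Ici
    ((hg.integrableOn_pow m).mono_set Ioo_subset_Ioi_self)
    ((hg.integrableOn_pow m).mono_set (Ici_subset_Ioi.2 hg.horizon_pos)),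
    integral_Ici_eq_integral_Ioi, setIntegral_eq_zero_of_forall_eq_zero (t := Ioi δ)
      fun r hr => by rw [hg.eq_zero r hr, mul_zero], add_zero]
  · exact disjoint_left.2 fun r hr hr' => hr.2.not_ge hr'

lemma IsKernelProfile.integrable_norm_pow (hg : IsKernelProfile σ δ g) (m : ℕ) :
    Integrable fun z : Plane => ‖z‖ ^ m * g ‖z‖ := by
  refine (integrable_fun_norm_addHaar (volume : Measure Plane) (f := fun r => r ^ m * g r)).2 ?_
  refine (hg.integrableOn_pow (m + 1)).congr_fun (fun r _ => ?_) measurableSet_Ioi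
  simp
  ring

/-- Polar coordinates give `2π ∫ r³ g`, which is four times the normalized moment `(π / 2) ∫ r³ g`.
-/
lemma IsKernelProfile.integral_norm_sq (hg : IsKernelProfile σ δ g) :
    ∫ z : Plane, ‖z‖ ^ 2 * g ‖z‖ = 4 * σ := by
  have h := integral_fun_norm_addHaar (volume : Measure Plane) (fun r => r ^ 2 * g r)
  rw [h, ← hg.second_moment]
  have h3 := hg.integral_Ioi_pow 3
  have h4 : ∫ r in Ioi (0 : ℝ), r ^ (Module.finrank ℝ Plane - 1) • (r ^ 2 * g r) =
      ∫ r in Ioi (0 : ℝ), r ^ 3 * g r := by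
    congr 1; funext r; simp; ring
  rw [h4, h3, Measure.real, EuclideanSpace.volume_ball_fin_two]
  simp [ENNReal.toReal_ofReal Real.pi_pos.le]
  ring

/-- An even, nonnegative and integrable function on the plane, supported in the ball of radius
`δ`, whose matrix of second moments is `2 σ` times the identity. -/
structure IsIsotropicKernel (σ δ : ℝ) (k : Plane → ℝ) : Prop where
  horizon_pos : 0 < δ
  nonneg : ∀ z, 0 ≤ k z
  even : ∀ z, k (-z) = k z
  eq_zero : ∀ z, δ < ‖z‖ → k z = 0
  integrable : Integrable k
  integral_norm_sq : ∫ z, ‖z‖ ^ 2 * k z = 4 * σ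
  integral_inner : ∀ (a : Plane) (Λ : Plane →L[ℝ] ℝ),
    ∫ z, inner ℝ a z * Λ z * k z = 2 * σ * Λ a

/-- The rotation of the plane by a right angle. -/
noncomputable def quarterTurn : Plane →ₗᵢ[ℝ] Plane where
  toFun v := !₂[-v 1, v 0]
  map_add' v w := by ext i; fin_cases i <;> simp [add_comm]
  map_smul' c v := by ext i; fin_cases i <;> simp
  norm_map' v := by
    have h : ‖(!₂[-v 1, v 0] : Plane)‖ ^ 2 = ‖v‖ ^ 2 := by
      rw [norm_sq_plane, norm_sq_plane]; simp; ring
    exact (sq_eq_sq₀ (norm_nonneg _) (norm_nonneg _)).1 h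

lemma integral_comp_quarterTurn (F : Plane → ℝ) : ∫ z, F (quarterTurn z) = ∫ z, F z := by
  let L := quarterTurn.toLinearIsometryEquiv rfl
  have h : MeasurePreserving L := L.measurePreserving
  exact h.integral_comp L.toHomeomorph.measurableEmbedding F

lemma IsKernelProfile.integrable_mul_coord (hg : IsKernelProfile σ δ g) (i j : Fin 2) :
    Integrable fun z : Plane => z i * z j * g ‖z‖ := by
  have h0 : AEStronglyMeasurable (fun z : Plane => g ‖z‖) := by
    simpa using (hg.integrable_norm_pow 0).aestronglyMeasurable
  refine (hg.integrable_norm_pow 2).mono'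
    ((by fun_prop : Continuous fun z : Plane => z i * z j).aestronglyMeasurable.mul h0)
    (Eventually.of_forall fun z => ?_)
  rw [norm_mul, norm_mul, Real.norm_of_nonneg (hg.nonneg _ (norm_nonneg _)), pow_two]
  exact mul_le_mul_of_nonneg_right
    (mul_le_mul (PiLp.norm_apply_le z i) (PiLp.norm_apply_le z j) (norm_nonneg _) (norm_nonneg _))
    (hg.nonneg _ (norm_nonneg _))

lemma IsKernelProfile.isIsotropicKernel (hg : IsKernelProfile σ δ g) :
    IsIsotropicKernel σ δ fun z => g ‖z‖ where
  horizon_pos := hg.horizon_pos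
  nonneg z := hg.nonneg _ (norm_nonneg _)
  even z := by rw [norm_neg]
  eq_zero z hz := hg.eq_zero _ hz
  integrable := by simpa using hg.integrable_norm_pow 0
  integral_norm_sq := hg.integral_norm_sq
  integral_inner a Λ := by
    -- A quarter turn flips the sign of the mixed moment and exchanges the diagonal ones, so each
    -- diagonal moment is half of `4 σ`.
    have h01 : ∫ z : Plane, z 0 * z 1 * g ‖z‖ = 0 := by
      have h := integral_comp_quarterTurn fun z : Plane => z 0 * z 1 * g ‖z‖
      simp only [LinearIsometry.norm_map] at h
      have h2 : ∀ z : Plane, quarterTurn z 0 * quarterTurn z 1 * g ‖z‖ =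
          -(z 0 * z 1 * g ‖z‖) := fun z => by
        simp only [quarterTurn, LinearIsometry.coe_mk, LinearMap.coe_mk, AddHom.coe_mk]
        simp; ring_nf; simp
      simp_rw [h2, integral_neg] at h
      linarith
    have h00 : ∫ z : Plane, z 0 * z 0 * g ‖z‖ = ∫ z : Plane, z 1 * z 1 * g ‖z‖ := by
      have h := integral_comp_quarterTurn fun z : Plane => z 0 * z 0 * g ‖z‖
      simp only [LinearIsometry.norm_map] at h
      rw [← h]
      congr 1; funext z; simp [quarterTurn]
    have hs := hg.integral_norm_sq
    simp_rw [norm_sq_plane, pow_two, add_mul] at hs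
    rw [integral_add (hg.integrable_mul_coord 0 0) (hg.integrable_mul_coord 1 1), h00] at hs
    have hΛ : ∀ z : Plane, Λ z = z 0 * Λ !₂[1, 0] + z 1 * Λ !₂[0, 1] := fun z => by
      rw [← smul_eq_mul, ← smul_eq_mul, ← map_smul, ← map_smul, ← map_add]
      congr 1
      ext i; fin_cases i <;> simp
    have e : ∀ z : Plane, inner ℝ a z * Λ z * g ‖z‖ =
        a 0 * Λ !₂[1, 0] * (z 0 * z 0 * g ‖z‖) + a 1 * Λ !₂[0, 1] * (z 1 * z 1 * g ‖z‖) +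
        (a 0 * Λ !₂[0, 1] + a 1 * Λ !₂[1, 0]) * (z 0 * z 1 * g ‖z‖) := fun z => by
      rw [hΛ z, inner_plane]; ring
    simp_rw [e]
    rw [integral_add (Integrable.fun_add ((hg.integrable_mul_coord 0 0).const_mul _)
      ((hg.integrable_mul_coord 1 1).const_mul _)) ((hg.integrable_mul_coord 0 1).const_mul _),
      integral_add ((hg.integrable_mul_coord 0 0).const_mul _)
      ((hg.integrable_mul_coord 1 1).const_mul _)]
    simp_rw [integral_const_mul]
    rw [h01, h00, hΛ a]
    linear_combination (a 0 * Λ !₂[1, 0] + a 1 * Λ !₂[0, 1]) / 2 * hs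

end Kernel

/-! ### Double integrals against an even, isotropic kernel -/

section KernelPairing

variable {σ δ : ℝ} {k : Plane → ℝ}

/-- The integral of `Φ` against the translation invariant kernel `k (y - x)`. -/
noncomputable def kernelPairing (k : Plane → ℝ) (Φ : Plane × Plane → ℝ) : ℝ :=
  ∫ q : Plane × Plane, Φ q * k (q.2 - q.1)

/-- The change of variables `(x, z) ↦ (x, x + z)` makes the kernel depend on one variable. -/
lemma measurePreserving_shear :
    MeasurePreserving (MeasurableEquiv.shearAddRight Plane)
      (volume : Measure (Plane × Plane)) volume :=
  measurePreserving_prod_add volume volume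

lemma integrable_shear_iff {F : Plane × Plane → ℝ} :
    Integrable (fun q : Plane × Plane => F (q.1, q.1 + q.2)) ↔ Integrable F :=
  measurePreserving_shear.integrable_comp_emb (MeasurableEquiv.measurableEmbedding _)

lemma integral_shear (F : Plane × Plane → ℝ) :
    ∫ q : Plane × Plane, F (q.1, q.1 + q.2) = ∫ q, F q :=
  measurePreserving_shear.integral_comp' F

lemma kernelPairing_swap (hk : IsIsotropicKernel σ δ k) (Φ : Plane × Plane → ℝ) :
    kernelPairing k (fun q => Φ q.swap) = kernelPairing k Φ := by
  rw [kernelPairing, kernelPairing]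
  have h := integral_prod_swap (μ := (volume : Measure Plane)) (ν := (volume : Measure Plane))
    (fun q : Plane × Plane => Φ q * k (q.2 - q.1))
  rw [Measure.volume_eq_prod, ← h]
  congr 1
  funext q
  simp only [Prod.fst_swap, Prod.snd_swap]
  rw [← hk.even, neg_sub]

lemma IsIsotropicKernel.integrable_norm_pow_mul (hk : IsIsotropicKernel σ δ k) (m : ℕ) :
    Integrable fun z => ‖z‖ ^ m * k z := by
  refine (hk.integrable.const_mul (δ ^ m)).mono'
    ((by fun_prop : Continuous fun z : Plane => ‖z‖ ^ m).aestronglyMeasurable.mul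
      hk.integrable.aestronglyMeasurable) (Eventually.of_forall fun z => ?_)
  rw [norm_mul, Real.norm_of_nonneg (hk.nonneg z), norm_pow, norm_norm]
  by_cases hz : δ < ‖z‖
  · simp [hk.eq_zero z hz]
  · have := hk.nonneg z
    gcongr
    exact not_lt.1 hz

lemma IsIsotropicKernel.moment_nonneg (hk : IsIsotropicKernel σ δ k) : 0 ≤ σ := by
  have : 0 ≤ ∫ z, ‖z‖ ^ 2 * k z :=
    integral_nonneg fun z => mul_nonneg (by positivity) (hk.nonneg z)
  rw [hk.integral_norm_sq] at this
  linarith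

/-- On the support one factor `‖z‖` is at most `δ`. This is the source of first order in the main
term. -/
lemma IsIsotropicKernel.integral_norm_cube_le (hk : IsIsotropicKernel σ δ k) :
    ∫ z, ‖z‖ ^ 3 * k z ≤ 4 * σ * δ := by
  rw [← hk.integral_norm_sq, mul_comm, ← integral_const_mul]
  refine integral_mono (hk.integrable_norm_pow_mul 3) ((hk.integrable_norm_pow_mul 2).const_mul _)
    fun z => ?_
  by_cases hz : δ < ‖z‖
  · simp [hk.eq_zero z hz]
  · have := mul_le_mul_of_nonneg_right (not_lt.1 hz)
      (mul_nonneg (pow_nonneg (norm_nonneg z) 2) (hk.nonneg z))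
    simp only
    linarith

lemma IsIsotropicKernel.integrable_indicator_mul (hk : IsIsotropicKernel σ δ k) (m : ℕ)
    {A : Set Plane} (hA : MeasurableSet A) (hA' : volume A ≠ ⊤) :
    Integrable fun q : Plane × Plane =>
      A.indicator 1 q.1 * (‖q.2 - q.1‖ ^ m * k (q.2 - q.1)) := by
  rw [← integrable_shear_iff]
  simp only [add_sub_cancel_left]
  refine Integrable.mul_prod (f := A.indicator (1 : Plane → ℝ)) ?_ (hk.integrable_norm_pow_mul m)
  exact (integrable_indicator_iff hA).2 (integrableOn_const hA')

lemma IsIsotropicKernel.integrable_mul (hk : IsIsotropicKernel σ δ k) {Φ : Plane × Plane → ℝ}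
    (hΦ : AEStronglyMeasurable Φ) {A : Set Plane} (hA : MeasurableSet A) (hA' : volume A ≠ ⊤)
    {M : ℝ} (hM : ∀ q : Plane × Plane, ‖q.2 - q.1‖ ≤ δ → |Φ q| ≤ M * A.indicator 1 q.1) :
    Integrable fun q : Plane × Plane => Φ q * k (q.2 - q.1) := by
  have hkm : AEStronglyMeasurable fun q : Plane × Plane => k (q.2 - q.1) := by
    have h := hk.integrable.aestronglyMeasurable.comp_quasiMeasurePreserving
      ((Measure.quasiMeasurePreserving_snd (μ := (volume : Measure Plane))).comp
        (measurePreserving_shear.symm _).quasiMeasurePreserving)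
    refine h.congr (Eventually.of_forall fun q => ?_)
    simp [MeasurableEquiv.shearAddRight, neg_add_eq_sub]
  refine ((hk.integrable_indicator_mul 0 hA hA').const_mul M).mono' (hΦ.mul hkm)
    (Eventually.of_forall fun q => ?_)
  rw [norm_mul, Real.norm_of_nonneg (hk.nonneg _), Real.norm_eq_abs, pow_zero, one_mul,
    ← mul_assoc]
  by_cases hq : δ < ‖q.2 - q.1‖
  · simp [hk.eq_zero _ hq]
  · exact mul_le_mul_of_nonneg_right (hM q (not_lt.1 hq)) (hk.nonneg _)

/-- After shearing, the bound splits into the area of `A` times the second moment; small area is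
what makes second-order integrands negligible. -/
lemma IsIsotropicKernel.abs_kernelPairing_le (hk : IsIsotropicKernel σ δ k)
    {Φ : Plane × Plane → ℝ} {A : Set Plane} (hA : MeasurableSet A) (hA' : volume A ≠ ⊤) {M : ℝ}
    (hM : ∀ q : Plane × Plane, ‖q.2 - q.1‖ ≤ δ →
      |Φ q| ≤ M * A.indicator 1 q.1 * ‖q.2 - q.1‖ ^ 2) :
    |kernelPairing k Φ| ≤ M * (volume.real A * (4 * σ)) := by
  have h1 : ∫ q : Plane × Plane, A.indicator (1 : Plane → ℝ) q.1 *
      (‖q.2 - q.1‖ ^ 2 * k (q.2 - q.1)) = volume.real A * (4 * σ) := by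
    rw [← integral_shear]
    simp only [add_sub_cancel_left]
    rw [Measure.volume_eq_prod, integral_prod_mul (A.indicator (1 : Plane → ℝ))
      (fun z => ‖z‖ ^ 2 * k z), hk.integral_norm_sq, integral_indicator_one hA]
  rw [← h1, ← integral_const_mul, kernelPairing, ← Real.norm_eq_abs]
  refine norm_integral_le_of_norm_le ((hk.integrable_indicator_mul 2 hA hA').const_mul M)
    (Eventually.of_forall fun q => ?_)
  rw [norm_mul, Real.norm_of_nonneg (hk.nonneg _), Real.norm_eq_abs]
  by_cases hq : δ < ‖q.2 - q.1‖
  · simp [hk.eq_zero _ hq]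
  · have := mul_le_mul_of_nonneg_right (hM q (not_lt.1 hq)) (hk.nonneg (q.2 - q.1))
    linarith

end KernelPairing

/-! ### Taylor expansion of the symmetrized integrand -/

section SymmetricPart

variable {n : ℕ} {P : Polygon Plane n}

/-- The symmetrized integrand `(u (x + z) - u x) (v x + v (x + z)) / 4`. -/
noncomputable def symmDiffProd (u v : Plane → ℝ) (z x : Plane) : ℝ :=
  (u (x + z) - u x) * (v x + v (x + z)) / 4

lemma contDiff_symmDiffProd {u v : Plane → ℝ} (hu : ContDiff ℝ 1 u) (hv : ContDiff ℝ 1 v)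
    (z : Plane) : ContDiff ℝ 1 (symmDiffProd u v z) := by
  have h : ContDiff ℝ 1 fun x : Plane => x + z := contDiff_id.add contDiff_const
  unfold symmDiffProd
  exact (((hu.comp h).sub hu).mul (hv.add (hv.comp h))).div_const 4

lemma hasCompactSupport_symmDiffProd {u : Plane → ℝ} (v : Plane → ℝ) (hu : HasCompactSupport u)
    (z : Plane) : HasCompactSupport (symmDiffProd u v z) := by
  have h1 : HasCompactSupport fun x => u (x + z) := hu.comp_homeomorph (Homeomorph.addRight z)
  have h2 : HasCompactSupport fun x => u (x + z) - u x := h1.sub hu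
  have h3 : HasCompactSupport fun x => (u (x + z) - u x) * (v x + v (x + z)) := h2.mul_right
  refine h3.comp_left (g := fun t => t / 4) (by simp)

/-- Second order bound for the symmetrized integrand near a point `p`. -/
lemma exists_symmDiffProd_le {u v : Plane → ℝ} (hu : ContDiff ℝ 2 u) (huc : HasCompactSupport u)
    (hv : ContDiff ℝ 1 v) (hvc : HasCompactSupport v) :
    ∃ C, 0 ≤ C ∧ ∀ p z : Plane, ∀ s ∈ Icc (0 : ℝ) 1,
      |symmDiffProd u v z (p - s • z) - fderiv ℝ u p z * v p / 2| ≤ C * ‖z‖ ^ 2 := by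
  have hu1 : ContDiff ℝ 1 u := hu.of_le one_le_two
  obtain ⟨Lu, hLu⟩ := hu1.lipschitzWith_of_hasCompactSupport huc one_ne_zero
  obtain ⟨Lv, hLv⟩ := hv.lipschitzWith_of_hasCompactSupport hvc one_ne_zero
  obtain ⟨L2, hL2⟩ := (hu.fderiv_right (m := 1) le_rfl).lipschitzWith_of_hasCompactSupport
    (huc.fderiv ℝ) one_ne_zero
  obtain ⟨M, hM⟩ := hv.continuous.bounded_above_of_compact_support hvc
  have hM0 : 0 ≤ M := (norm_nonneg _).trans (hM 0)
  refine ⟨L2 * M / 2 + Lu * Lv / 2, by positivity, fun p z s hs => ?_⟩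
  set x := p - s • z with hx
  have hsz : ∀ r : ℝ, |r| ≤ 1 → ‖r • z‖ ≤ ‖z‖ := fun r hr => by
    rw [norm_smul, Real.norm_eq_abs]
    exact mul_le_of_le_one_left (norm_nonneg _) hr
  -- Mean value inequality for `u` minus its linear part at `p`: the segment from `x` to `x + z`
  -- stays within `‖z‖` of `p`, where the derivative varies by at most `L2 * ‖z‖`.
  have hA : |u (x + z) - u x - fderiv ℝ u p z| ≤ L2 * ‖z‖ ^ 2 := by
    have h := (convex_segment x (x + z)).norm_image_sub_le_of_norm_fderiv_le' (𝕜 := ℝ)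
      (f := u) (φ := fderiv ℝ u p) (C := L2 * ‖z‖)
      (fun w _ => hu1.differentiable one_ne_zero w) (fun w hw => ?_)
      (left_mem_segment ℝ _ _) (right_mem_segment ℝ _ _)
    · rw [add_sub_cancel_left] at h
      rw [← Real.norm_eq_abs]
      linarith
    · rw [segment_eq_image'] at hw
      obtain ⟨r, hr, rfl⟩ := hw
      have h1 := hL2.dist_le_mul (x + r • (x + z - x)) p
      rw [dist_eq_norm, dist_eq_norm] at h1
      refine h1.trans (mul_le_mul_of_nonneg_left ?_ L2.2)
      have : x + r • (x + z - x) - p = (r - s) • z := by rw [hx]; module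
      rw [this]
      exact hsz _ (abs_le.2 ⟨by linarith [hr.1, hs.2], by linarith [hr.2, hs.1]⟩)
  have hB : |v x + v (x + z)| ≤ 2 * M := by
    have h1 := hM x
    have h2 := hM (x + z)
    rw [Real.norm_eq_abs] at h1 h2
    linarith [abs_add_le (v x) (v (x + z))]
  have hA0 : |fderiv ℝ u p z| ≤ Lu * ‖z‖ := by
    rw [← Real.norm_eq_abs]
    exact (fderiv ℝ u p).le_of_opNorm_le (norm_fderiv_le_of_lipschitz ℝ hLu) z
  have hB0 : |v x + v (x + z) - 2 * v p| ≤ 2 * (Lv * ‖z‖) := by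
    have h1 : |v x - v p| ≤ Lv * ‖z‖ := by
      have := hLv.dist_le_mul x p
      rw [Real.dist_eq, dist_eq_norm] at this
      refine this.trans (mul_le_mul_of_nonneg_left ?_ Lv.2)
      rw [show x - p = (-s) • z by rw [hx]; module]
      exact hsz _ (abs_le.2 ⟨by linarith [hs.2], by linarith [hs.1]⟩)
    have h2 : |v (x + z) - v p| ≤ Lv * ‖z‖ := by
      have := hLv.dist_le_mul (x + z) p
      rw [Real.dist_eq, dist_eq_norm] at this
      refine this.trans (mul_le_mul_of_nonneg_left ?_ Lv.2)
      rw [show x + z - p = (1 - s) • z by rw [hx]; module]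
      exact hsz _ (abs_le.2 ⟨by linarith [hs.2], by linarith [hs.1]⟩)
    have := abs_add_le (v x - v p) (v (x + z) - v p)
    rw [show v x - v p + (v (x + z) - v p) = v x + v (x + z) - 2 * v p by ring] at this
    linarith
  have e : symmDiffProd u v z x - fderiv ℝ u p z * v p / 2 =
      (u (x + z) - u x - fderiv ℝ u p z) * (v x + v (x + z)) / 4 +
      fderiv ℝ u p z * (v x + v (x + z) - 2 * v p) / 4 := by
    rw [symmDiffProd]; ring
  rw [e]
  refine (abs_add_le _ _).trans ?_
  rw [abs_div, abs_div, abs_mul, abs_mul, abs_of_pos (by norm_num : (0 : ℝ) < 4)]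
  have h1 := mul_le_mul hA hB (abs_nonneg _) (by positivity)
  have h2 := mul_le_mul hA0 hB0 (abs_nonneg _) (by positivity)
  linarith

end SymmetricPart

/-! ### Asymptotics of the symmetrized pairing -/

section SymmetricPairing

variable {n : ℕ} {P : Polygon Plane n} {u v : Plane → ℝ}

/-- The integrand of the symmetrized pairing. -/
noncomputable def symmIntegrand (P : Polygon Plane n) (u v : Plane → ℝ) (q : Plane × Plane) : ℝ :=
  ((region P).indicator 1 q.1 - (region P).indicator 1 q.2) * symmDiffProd u v (q.2 - q.1) q.1

lemma measurable_indicator_region : Measurable ((region P).indicator (1 : Plane → ℝ)) :=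
  measurable_one.indicator isOpen_region.measurableSet

lemma exists_abs_symmDiffProd_le (hu : Continuous u) (huc : HasCompactSupport u)
    (hv : Continuous v) (hvc : HasCompactSupport v) :
    ∃ M, ∀ z x, |symmDiffProd u v z x| ≤ M := by
  obtain ⟨Mu, hMu⟩ := hu.bounded_above_of_compact_support huc
  obtain ⟨Mv, hMv⟩ := hv.bounded_above_of_compact_support hvc
  refine ⟨(Mu + Mu) * (Mv + Mv) / 4, fun z x => ?_⟩
  rw [symmDiffProd, abs_div, abs_mul, abs_of_pos (by norm_num : (0 : ℝ) < 4)]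
  have h0 : 0 ≤ Mu := (norm_nonneg _).trans (hMu 0)
  gcongr
  · exact (norm_sub_le _ _).trans (add_le_add (hMu _) (hMu _))
  · exact (norm_add_le _ _).trans (add_le_add (hMv _) (hMv _))

lemma integrable_symmIntegrand (hu : Continuous u) (huc : HasCompactSupport u)
    (hv : Continuous v) (hvc : HasCompactSupport v) {σ δ : ℝ} {k : Plane → ℝ}
    (hk : IsIsotropicKernel σ δ k) :
    Integrable fun q : Plane × Plane => symmIntegrand P u v q * k (q.2 - q.1) := by
  obtain ⟨M, hM⟩ := exists_abs_symmDiffProd_le hu huc hv hvc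
  have hm : Measurable (symmIntegrand P u v) := by
    refine ((measurable_indicator_region.comp measurable_fst).sub
      (measurable_indicator_region.comp measurable_snd)).mul ?_
    have : Continuous fun q : Plane × Plane => symmDiffProd u v (q.2 - q.1) q.1 := by
      unfold symmDiffProd
      fun_prop
    exact this.measurable
  -- The margin `1` leaves room for pairs at distance exactly `δ`, since a thickening is open.
  refine hk.integrable_mul (A := Metric.thickening (δ + 1) (region P)) (M := M)
    hm.aestronglyMeasurable Metric.isOpen_thickening.measurableSet
    (isBounded_region.thickening).measure_lt_top.ne fun q hq => ?_
  by_cases hx : q.1 ∈ Metric.thickening (δ + 1) (region P)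
  · rw [indicator_of_mem hx, Pi.one_apply, mul_one, symmIntegrand, abs_mul]
    refine (mul_le_of_le_one_left (abs_nonneg _) ?_).trans (hM _ _)
    by_cases h1 : q.1 ∈ region P <;> by_cases h2 : q.2 ∈ region P <;> simp [h1, h2]
  · rw [indicator_of_notMem hx]
    have h1 : q.1 ∉ region P := fun h =>
      hx (Metric.self_subset_thickening (by linarith [hk.horizon_pos]) _ h)
    have h2 : q.2 ∉ region P := fun h => hx <| by
      rw [Metric.mem_thickening_iff]
      exact ⟨q.2, h, by rw [dist_comm, dist_eq_norm]; linarith⟩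
    simp [symmIntegrand, h1, h2]

/-- The moment of `∂u v` over the `i`-th edge, parametrized by the unit interval. -/
noncomputable def edgeMoment (P : Polygon Plane n) (u v : Plane → ℝ) (i : Fin n) :
    Plane →L[ℝ] ℝ :=
  ∫ t in (0 : ℝ)..1, v (P.edgePath ℝ i t) • fderiv ℝ u (P.edgePath ℝ i t)

lemma continuous_edgePath (i : Fin n) : Continuous (P.edgePath ℝ i) :=
  (P.edgePath ℝ i).continuous_of_finiteDimensional

lemma edgeMoment_apply (hu : ContDiff ℝ 1 u) (hv : Continuous v) (i : Fin n) (z : Plane) :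
    edgeMoment P u v i z =
      ∫ t in (0 : ℝ)..1, v (P.edgePath ℝ i t) * fderiv ℝ u (P.edgePath ℝ i t) z := by
  have hc : Continuous fun t : ℝ => v (P.edgePath ℝ i t) • fderiv ℝ u (P.edgePath ℝ i t) :=
    (hv.comp (continuous_edgePath i)).smul
      ((hu.continuous_fderiv one_ne_zero).comp (continuous_edgePath i))
  rw [edgeMoment, ContinuousLinearMap.intervalIntegral_apply (hc.intervalIntegrable _ _)]
  simp

lemma boundaryPairing_eq (hu : ContDiff ℝ 1 u) (hv : Continuous v) (σ : ℝ) :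
    boundaryPairing P σ u v =
      ∑ i, edgeLength P i * (σ * edgeMoment P u v i (outerNormal P i)) := by
  rw [boundaryPairing]
  refine Finset.sum_congr rfl fun i _ => ?_
  rw [edgeMoment_apply hu hv, ← intervalIntegral.integral_const_mul,
    ← intervalIntegral.integral_const_mul]
  congr 1
  funext t
  ring

lemma abs_integral_integral_sub_le {F : ℝ → ℝ → ℝ} {f : ℝ → ℝ}
    (hF : Continuous fun q : ℝ × ℝ => F q.1 q.2) (hf : Continuous f) {K : ℝ}
    (h : ∀ s ∈ Icc (0 : ℝ) 1, ∀ t, |F s t - f t| ≤ K) :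
    |(∫ s in (0 : ℝ)..1, ∫ t in (0 : ℝ)..1, F s t) - ∫ t in (0 : ℝ)..1, f t| ≤ K := by
  have e : ∫ t in (0 : ℝ)..1, f t = ∫ _ in (0 : ℝ)..1, ∫ t in (0 : ℝ)..1, f t := by simp
  have hc : Continuous fun s : ℝ => ∫ t in (0 : ℝ)..1, F s t :=
    intervalIntegral.continuous_parametric_intervalIntegral_of_continuous' hF _ _
  rw [e, ← intervalIntegral.integral_sub (hc.intervalIntegrable _ _)
    (continuous_const.intervalIntegrable _ _), ← Real.norm_eq_abs]
  refine (intervalIntegral.norm_integral_le_of_norm_le_const (C := K)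
    fun s hs => ?_).trans (by simp)
  rw [uIoc_of_le zero_le_one] at hs
  have hc' : Continuous fun t : ℝ => F s t :=
    hF.comp (by fun_prop : Continuous fun t : ℝ => (s, t))
  rw [← intervalIntegral.integral_sub (hc'.intervalIntegrable _ _) (hf.intervalIntegrable _ _)]
  refine (intervalIntegral.norm_integral_le_of_norm_le_const (C := K)
    fun t _ => ?_).trans (by simp)
  exact h s ⟨hs.1.le, hs.2⟩ t

/-- Translating the second indicator gives the difference treated by
`integral_region_sub_translate`. The integrand has an `O(‖z‖²)` error near each edge, and the factor
`n · z` supplies the third power. -/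
lemma IsConvexCCW.integral_symmIntegrand_sub_le (hP : IsConvexCCW P) (hu : ContDiff ℝ 2 u)
    (huc : HasCompactSupport u) (hv : ContDiff ℝ 1 v) (hvc : HasCompactSupport v) :
    ∃ C, 0 ≤ C ∧ ∀ z, |(∫ x, symmIntegrand P u v (x, x + z)) - ∑ i, inner ℝ (outerNormal P i) z *
      (edgeLength P i * (edgeMoment P u v i z / 2))| ≤ C * ‖z‖ ^ 3 := by
  obtain ⟨C, hC0, hC⟩ := exists_symmDiffProd_le hu huc hv hvc
  have hu1 : ContDiff ℝ 1 u := hu.of_le one_le_two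
  have hl := fun i => (hP.edgeLength_pos i).le
  refine ⟨∑ i, edgeLength P i * C, Finset.sum_nonneg fun i _ => mul_nonneg (hl i) hC0,
    fun z => ?_⟩
  have hG := contDiff_symmDiffProd hu1 hv z
  have hGc := hasCompactSupport_symmDiffProd v huc z
  have hGi := hG.continuous.integrable_of_hasCompactSupport (μ := volume) hGc
  have hH := isOpen_region (P := P).measurableSet
  have h1 : ∫ x, symmIntegrand P u v (x, x + z) =
      ∫ x in region P, (symmDiffProd u v z x - symmDiffProd u v z (x - z)) := by
    rw [integral_sub hGi.integrableOn (hGi.comp_sub_right z).integrableOn]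
    have e : ∀ x, symmIntegrand P u v (x, x + z) = (region P).indicator (symmDiffProd u v z) x -
        (region P).indicator (fun x => symmDiffProd u v z (x - z)) (x + z) := fun x => by
      rw [symmIntegrand]
      simp only [add_sub_cancel_left]
      by_cases h1 : x ∈ region P <;> by_cases h2 : x + z ∈ region P <;> simp [h1, h2]
    simp_rw [e]
    rw [integral_sub (hGi.indicator hH)
      (((hGi.comp_sub_right z).indicator hH).comp_add_right z),
      integral_add_right_eq_self (fun x => (region P).indicator
        (fun x => symmDiffProd u v z (x - z)) x), integral_indicator hH, integral_indicator hH]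
  rw [h1, hP.integral_region_sub_translate hG hGc, ← Finset.sum_sub_distrib, Finset.sum_mul]
  refine (Finset.abs_sum_le_sum_abs _ _).trans (Finset.sum_le_sum fun i _ => ?_)
  rw [← mul_sub, ← mul_sub, abs_mul, abs_mul, abs_of_nonneg (hl i)]
  have h2 : |(∫ s in (0 : ℝ)..1, ∫ t in (0 : ℝ)..1,
      symmDiffProd u v z (P.edgePath ℝ i t - s • z)) - edgeMoment P u v i z / 2| ≤
        C * ‖z‖ ^ 2 := by
    have hc1 : Continuous fun q : ℝ × ℝ => symmDiffProd u v z (P.edgePath ℝ i q.2 - q.1 • z) := by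
      have := continuous_edgePath (P := P) i
      exact hG.continuous.comp (by fun_prop)
    have hc2 : Continuous fun t : ℝ =>
        fderiv ℝ u (P.edgePath ℝ i t) z * v (P.edgePath ℝ i t) / 2 :=
      ((((hu1.continuous_fderiv one_ne_zero).comp (continuous_edgePath i)).clm_apply
        continuous_const).mul (hv.continuous.comp (continuous_edgePath i))).div_const 2
    have e1 : edgeMoment P u v i z / 2 = ∫ t in (0 : ℝ)..1,
        fderiv ℝ u (P.edgePath ℝ i t) z * v (P.edgePath ℝ i t) / 2 := by
      rw [intervalIntegral.integral_div, edgeMoment_apply hu1 hv.continuous]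
      simp_rw [mul_comm]
    rw [e1]
    exact abs_integral_integral_sub_le (F := fun s t => symmDiffProd u v z
      (P.edgePath ℝ i t - s • z)) hc1 hc2 fun s hs t => hC _ z s hs
  have h3 : |inner ℝ (outerNormal P i) z| ≤ ‖z‖ := by
    have := abs_real_inner_le_norm (outerNormal P i) z
    rwa [hP.norm_outerNormal, one_mul] at this
  calc _ ≤ ‖z‖ * (edgeLength P i * (C * ‖z‖ ^ 2)) :=
        mul_le_mul h3 (mul_le_mul_of_nonneg_left h2 (hl i))
          (mul_nonneg (hl i) (abs_nonneg _)) (norm_nonneg _)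
    _ = _ := by ring

/-- The symmetrized pairing approximates the boundary pairing to first order in the horizon. -/
theorem IsConvexCCW.kernelPairing_symmIntegrand_sub_le (hP : IsConvexCCW P) (hu : ContDiff ℝ 2 u)
    (huc : HasCompactSupport u) (hv : ContDiff ℝ 1 v) (hvc : HasCompactSupport v) :
    ∃ C, 0 ≤ C ∧ ∀ (σ δ : ℝ) (k : Plane → ℝ), IsIsotropicKernel σ δ k →
      |kernelPairing k (symmIntegrand P u v) - boundaryPairing P σ u v| ≤ C * (4 * σ * δ) := by
  obtain ⟨C, hC0, hC⟩ := hP.integral_symmIntegrand_sub_le hu huc hv hvc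
  have hu1 : ContDiff ℝ 1 u := hu.of_le one_le_two
  refine ⟨C, hC0, fun σ δ k hk => ?_⟩
  have hint := integrable_shear_iff.2
    (integrable_symmIntegrand (P := P) hu.continuous huc hv.continuous hvc hk)
  simp only [add_sub_cancel_left] at hint
  rw [Measure.volume_eq_prod] at hint
  have e1 : kernelPairing k (symmIntegrand P u v) =
      ∫ z, (∫ x, symmIntegrand P u v (x, x + z)) * k z := by
    rw [kernelPairing, ← integral_shear]
    simp only [add_sub_cancel_left]
    rw [Measure.volume_eq_prod, integral_prod_symm _ hint]
    simp_rw [integral_mul_const]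
  have hint1 : Integrable fun z => (∫ x, symmIntegrand P u v (x, x + z)) * k z := by
    have := hint.integral_prod_right
    simp_rw [integral_mul_const] at this
    exact this
  have hinti : ∀ i, Integrable fun z => inner ℝ (outerNormal P i) z *
      edgeMoment P u v i z * k z := fun i => by
    refine ((hk.integrable_norm_pow_mul 2).const_mul (‖edgeMoment P u v i‖)).mono'
      ((by fun_prop : Continuous fun z : Plane => inner ℝ (outerNormal P i) z *
        edgeMoment P u v i z).aestronglyMeasurable.mul hk.integrable.aestronglyMeasurable)
      (Eventually.of_forall fun z => ?_)
    rw [norm_mul, norm_mul, Real.norm_of_nonneg (hk.nonneg z)]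
    have h1 := norm_inner_le_norm (𝕜 := ℝ) (outerNormal P i) z
    rw [hP.norm_outerNormal, one_mul] at h1
    have h2 := mul_le_mul h1 ((edgeMoment P u v i).le_opNorm z) (norm_nonneg _) (norm_nonneg _)
    have := mul_le_mul_of_nonneg_right h2 (hk.nonneg z)
    linarith
  have e2 : ∀ z, (∑ i, inner ℝ (outerNormal P i) z *
      (edgeLength P i * (edgeMoment P u v i z / 2))) * k z = ∑ i, edgeLength P i / 2 *
        (inner ℝ (outerNormal P i) z * edgeMoment P u v i z * k z) := fun z => by
    rw [Finset.sum_mul]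
    exact Finset.sum_congr rfl fun i _ => by ring
  have hint2 : Integrable fun z => (∑ i, inner ℝ (outerNormal P i) z *
      (edgeLength P i * (edgeMoment P u v i z / 2))) * k z := by
    simp_rw [e2]
    exact integrable_finsetSum _ fun i _ => (hinti i).const_mul _
  -- Isotropy evaluates the leading terms exactly: the moment `2 σ` cancels the `1 / 2` from
  -- averaging.
  have e3 : boundaryPairing P σ u v = ∫ z, (∑ i, inner ℝ (outerNormal P i) z *
      (edgeLength P i * (edgeMoment P u v i z / 2))) * k z := by
    simp_rw [e2]
    rw [integral_finsetSum _ fun i _ => (hinti i).const_mul _,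
      boundaryPairing_eq hu1 hv.continuous]
    refine Finset.sum_congr rfl fun i _ => ?_
    rw [integral_const_mul, hk.integral_inner]
    ring
  rw [e1, e3, ← integral_sub hint1 hint2]
  refine le_trans ?_ (mul_le_mul_of_nonneg_left hk.integral_norm_cube_le hC0)
  rw [← integral_const_mul, ← Real.norm_eq_abs]
  refine norm_integral_le_of_norm_le ((hk.integrable_norm_pow_mul 3).const_mul C)
    (Eventually.of_forall fun z => ?_)
  rw [← sub_mul, norm_mul, Real.norm_of_nonneg (hk.nonneg z), ← mul_assoc]
  exact mul_le_mul_of_nonneg_right (hC z) (hk.nonneg z)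

end SymmetricPairing

/-! ### Comparison of the three operators with the symmetrized pairing -/

section Comparison

variable {Ω : Set Plane} {u v : Plane → ℝ} {σ δ : ℝ} {k : Plane → ℝ}

/-- The function `(u x - u y) (a v x + b v y)` of the pair `(x, y)`. -/
def diffProd (u v : Plane → ℝ) (a b : ℝ) (q : Plane × Plane) : ℝ :=
  (u q.1 - u q.2) * (a * v q.1 + b * v q.2)

/-- `diffProd` restricted to `x` in the outer strip and `y ∈ S`. -/
noncomputable def stripDiffProd (Ω : Set Plane) (δ : ℝ) (S : Set Plane) (u v : Plane → ℝ)
    (a b : ℝ) (q : Plane × Plane) : ℝ :=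
  (outerStrip Ω δ).indicator 1 q.1 * S.indicator 1 q.2 * diffProd u v a b q

lemma kernelPairing_congr (hk : IsIsotropicKernel σ δ k) {Φ Φ' : Plane × Plane → ℝ}
    (h : ∀ᵐ q : Plane × Plane, ‖q.2 - q.1‖ ≤ δ → Φ q = Φ' q) :
    kernelPairing k Φ = kernelPairing k Φ' := by
  refine integral_congr_ae ?_
  filter_upwards [h] with q hq
  by_cases hd : δ < ‖q.2 - q.1‖
  · simp [hk.eq_zero _ hd]
  · rw [hq (not_lt.1 hd)]

lemma exists_abs_diffProd_le (hu : Continuous u) (huc : HasCompactSupport u)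
    (hv : Continuous v) (hvc : HasCompactSupport v) (a b : ℝ) :
    ∃ M, 0 ≤ M ∧ ∀ q, |diffProd u v a b q| ≤ M := by
  obtain ⟨Mu, hMu⟩ := hu.bounded_above_of_compact_support huc
  obtain ⟨Mv, hMv⟩ := hv.bounded_above_of_compact_support hvc
  have h0 : 0 ≤ Mu := (norm_nonneg _).trans (hMu 0)
  have h0' : 0 ≤ Mv := (norm_nonneg _).trans (hMv 0)
  refine ⟨(Mu + Mu) * (|a| * Mv + |b| * Mv), by positivity, fun q => ?_⟩
  rw [diffProd, abs_mul]
  gcongr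
  · exact (norm_sub_le _ _).trans (add_le_add (hMu _) (hMu _))
  · refine (abs_add_le _ _).trans ?_
    rw [abs_mul, abs_mul]
    gcongr
    · exact hMv _
    · exact hMv _

lemma abs_indicator_mul_le (A S : Set Plane) (q : Plane × Plane) {w M : ℝ} (hw : |w| ≤ M) :
    |A.indicator 1 q.1 * S.indicator 1 q.2 * w| ≤ M * A.indicator 1 q.1 := by
  have h0 : 0 ≤ M := (abs_nonneg _).trans hw
  by_cases h1 : q.1 ∈ A <;> by_cases h2 : q.2 ∈ S <;> simp [h1, h2, h0, hw]

lemma integrable_indicator_diffProd (hk : IsIsotropicKernel σ δ k) {A S : Set Plane}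
    (hA : MeasurableSet A) (hA' : volume A ≠ ⊤) (hS : MeasurableSet S)
    (hu : Continuous u) (huc : HasCompactSupport u)
    (hv : Continuous v) (hvc : HasCompactSupport v) (a b : ℝ) :
    Integrable fun q : Plane × Plane => A.indicator 1 q.1 * S.indicator 1 q.2 *
      diffProd u v a b q * k (q.2 - q.1) := by
  obtain ⟨M, -, hM⟩ := exists_abs_diffProd_le hu huc hv hvc a b
  have hc : Continuous (diffProd u v a b) := by unfold diffProd; fun_prop
  refine hk.integrable_mul (Measurable.aestronglyMeasurable ?_) hA hA' (M := M)
    fun q _ => abs_indicator_mul_le _ _ _ (hM q)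
  exact (((measurable_one.indicator hA).comp measurable_fst).mul
    ((measurable_one.indicator hS).comp measurable_snd)).mul hc.measurable

/-- Opposite weights leave a product of a difference of `u` and a difference of `v`. -/
lemma abs_diffProd_neg_le {Lu Lv : NNReal} (hu : LipschitzWith Lu u) (hv : LipschitzWith Lv v)
    (a : ℝ) (q : Plane × Plane) :
    |diffProd u v a (-a) q| ≤ |a| * Lu * Lv * ‖q.2 - q.1‖ ^ 2 := by
  have h1 := hu.dist_le_mul q.1 q.2
  have h2 := hv.dist_le_mul q.1 q.2
  rw [Real.dist_eq, dist_comm, dist_eq_norm] at h1 h2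
  rw [diffProd, show a * v q.1 + -a * v q.2 = a * (v q.1 - v q.2) by ring, abs_mul, abs_mul]
  calc _ ≤ (Lu * ‖q.2 - q.1‖) * (|a| * (Lv * ‖q.2 - q.1‖)) := by gcongr
    _ = _ := by ring

lemma volume_outerStrip_ne_top (hb : Bornology.IsBounded Ω) : volume (outerStrip Ω δ) ≠ ⊤ :=
  ((isBounded_outerSet hb).subset sdiff_subset).measure_lt_top.ne

lemma kernelPairing_stripDiffProd_add (hb : Bornology.IsBounded Ω)
    (hu : Continuous u) (huc : HasCompactSupport u) (hv : Continuous v)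
    (hvc : HasCompactSupport v) (hk : IsIsotropicKernel σ δ k)
    {S : Set Plane} (hS : MeasurableSet S) (a b a' b' : ℝ) :
    kernelPairing k (stripDiffProd Ω δ S u v (a + a') (b + b')) =
      kernelPairing k (stripDiffProd Ω δ S u v a b) +
      kernelPairing k (stripDiffProd Ω δ S u v a' b') := by
  have hi := fun a b => integrable_indicator_diffProd hk (measurableSet_outerStrip (Ω := Ω)
    (δ := δ)) (volume_outerStrip_ne_top hb) hS hu huc hv hvc a b
  rw [kernelPairing, kernelPairing, kernelPairing]
  simp only [stripDiffProd]
  rw [← integral_add (hi a b) (hi a' b')]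
  congr 1
  funext q
  simp only [diffProd]
  ring

lemma abs_kernelPairing_stripDiffProd_le (hb : Bornology.IsBounded Ω)
    (hk : IsIsotropicKernel σ δ k) {Lu Lv : NNReal} (hu : LipschitzWith Lu u)
    (hv : LipschitzWith Lv v) (S : Set Plane) (a : ℝ) :
    |kernelPairing k (stripDiffProd Ω δ S u v a (-a))| ≤
      |a| * Lu * Lv * (volume.real (outerStrip Ω δ) * (4 * σ)) := by
  refine hk.abs_kernelPairing_le measurableSet_outerStrip (volume_outerStrip_ne_top hb)
    fun q _ => ?_
  rw [stripDiffProd]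
  refine (abs_indicator_mul_le _ _ _ (abs_diffProd_neg_le hu hv a q)).trans (le_of_eq ?_)
  ring

/-- Both variables range over the same set, so the part with equal weights is odd under exchanging
them and integrates to zero. -/
lemma kernelPairing_outerStrip (hb : Bornology.IsBounded Ω)
    (hu : Continuous u) (huc : HasCompactSupport u) (hv : Continuous v)
    (hvc : HasCompactSupport v) (hk : IsIsotropicKernel σ δ k) :
    kernelPairing k (stripDiffProd Ω δ (outerStrip Ω δ) u v 1 0) =
      kernelPairing k (stripDiffProd Ω δ (outerStrip Ω δ) u v (1 / 2) (-(1 / 2))) := by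
  have hadd := kernelPairing_stripDiffProd_add hb hu huc hv hvc hk
    (measurableSet_outerStrip (Ω := Ω) (δ := δ))
  have h1 : kernelPairing k (stripDiffProd Ω δ (outerStrip Ω δ) u v (1 / 2) (1 / 2)) =
      -kernelPairing k (stripDiffProd Ω δ (outerStrip Ω δ) u v (1 / 2) (1 / 2)) := by
    conv_lhs => rw [← kernelPairing_swap hk]
    rw [kernelPairing, kernelPairing, ← integral_neg]
    congr 1
    funext q
    simp only [stripDiffProd, diffProd, Prod.fst_swap, Prod.snd_swap]
    ring
  have h2 := hadd (1 / 2) (-(1 / 2)) (1 / 2) (1 / 2)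
  rw [show (1 / 2 : ℝ) + 1 / 2 = 1 by norm_num, neg_add_cancel] at h2
  linarith

lemma ae_notMem_frontier (hc : Convex ℝ Ω) :
    ∀ᵐ q : Plane × Plane, q.1 ∉ frontier Ω ∧ q.2 ∉ frontier Ω := by
  have h : ∀ᵐ x : Plane, x ∉ frontier Ω :=
    measure_eq_zero_iff_ae_notMem.1 (hc.addHaar_frontier volume)
  rw [Measure.volume_eq_prod]
  exact (Measure.quasiMeasurePreserving_fst.ae h).and (Measure.quasiMeasurePreserving_snd.ae h)

/-- The integrand of the pairing `(N u, v)`, extended by zero. -/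
noncomputable def opIntegrand (κ : NeumannKind) (Ω : Set Plane) (δ : ℝ) (u v : Plane → ℝ)
    (q : Plane × Plane) : ℝ :=
  (opDomain κ Ω δ).indicator 1 q.1 * (opRange κ Ω δ).indicator 1 q.2 * diffProd u v 1 0 q

/-- A point of `Ω` within reach of the outer strip is automatically in the inner strip, so `Ω` can
stand in for it. -/
lemma indicator_innerStrip {x y : Plane} (hδ : 0 < δ) (hx : x ∈ outerStrip Ω δ)
    (hxy : ‖y - x‖ ≤ δ) : (innerStrip Ω δ).indicator (1 : Plane → ℝ) y = Ω.indicator 1 y := by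
  have h : y ∈ innerStrip Ω δ ↔ y ∈ Ω :=
    ⟨fun h => h.1, fun h => mem_innerStrip_of_le hδ h hx.2 (by rwa [dist_eq_norm])⟩
  by_cases hy : y ∈ Ω
  · rw [indicator_of_mem hy, indicator_of_mem (h.2 hy)]
  · rw [indicator_of_notMem hy, indicator_of_notMem fun h' => hy (h.1 h')]

lemma kernelPairing_plus (hk : IsIsotropicKernel σ δ k) :
    kernelPairing k (opIntegrand .plus Ω δ u v) =
      kernelPairing k (stripDiffProd Ω δ Ω u v 1 0) := by
  refine kernelPairing_congr hk (Eventually.of_forall fun q hq => ?_)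
  simp only [opIntegrand, stripDiffProd, opDomain, opRange]
  by_cases hx : q.1 ∈ outerStrip Ω δ
  · rw [indicator_innerStrip hk.horizon_pos hx hq]
  · simp [hx]

/-- Exchanging the variables puts `x` outside and `y` inside; the sign of `u x - u y` cancels that
of the operator, and `v` is now evaluated at `y`. -/
lemma kernelPairing_minus (hk : IsIsotropicKernel σ δ k) :
    -kernelPairing k (opIntegrand .minus Ω δ u v) =
      kernelPairing k (stripDiffProd Ω δ Ω u v 0 1) := by
  rw [← kernelPairing_swap hk, kernelPairing, ← integral_neg]
  simp_rw [← neg_mul]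
  refine kernelPairing_congr hk (Eventually.of_forall fun q hq => ?_)
  simp only [opIntegrand, stripDiffProd, opDomain, opRange, diffProd, Prod.fst_swap,
    Prod.snd_swap]
  by_cases hx : q.1 ∈ outerStrip Ω δ
  · rw [indicator_innerStrip hk.horizon_pos hx hq]
    ring
  · simp [hx]

/-- Up to the null frontier of a convex set, `Ω⁺` is the disjoint union of `Ω` and the outer strip.
-/
lemma kernelPairing_star (ho : IsOpen Ω) (hc : Convex ℝ Ω) (hb : Bornology.IsBounded Ω)
    (hu : Continuous u) (huc : HasCompactSupport u) (hv : Continuous v)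
    (hvc : HasCompactSupport v) (hk : IsIsotropicKernel σ δ k) :
    kernelPairing k (opIntegrand .star Ω δ u v) =
      kernelPairing k (stripDiffProd Ω δ Ω u v 1 0) +
      kernelPairing k (stripDiffProd Ω δ (outerStrip Ω δ) u v 1 0) := by
  have hi := fun {S : Set Plane} (hS : MeasurableSet S) =>
    integrable_indicator_diffProd hk (measurableSet_outerStrip (Ω := Ω)
    (δ := δ)) (volume_outerStrip_ne_top hb) hS hu huc hv hvc 1 0
  have h1 : kernelPairing k (stripDiffProd Ω δ Ω u v 1 0) +
      kernelPairing k (stripDiffProd Ω δ (outerStrip Ω δ) u v 1 0) =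
      kernelPairing k fun q => stripDiffProd Ω δ Ω u v 1 0 q +
        stripDiffProd Ω δ (outerStrip Ω δ) u v 1 0 q := by
    rw [kernelPairing, kernelPairing, kernelPairing]
    simp only [stripDiffProd]
    rw [← integral_add (hi ho.measurableSet) (hi measurableSet_outerStrip)]
    simp_rw [add_mul]
  rw [h1]
  refine kernelPairing_congr hk ?_
  filter_upwards [ae_notMem_frontier hc] with q hq _
  simp only [opIntegrand, stripDiffProd, opDomain, opRange]
  by_cases h2 : q.2 ∈ Ω
  · have h3 : q.2 ∈ outerSet Ω δ := mem_outerSet h2 (by simpa using hk.horizon_pos)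
    have h4 : q.2 ∉ outerStrip Ω δ := fun h => h.2 (subset_closure h2)
    simp [h2, h3, h4]
  · have h3 : q.2 ∉ closure Ω := fun h => hq.2 ⟨h, by rwa [ho.interior_eq]⟩
    by_cases h4 : q.2 ∈ outerSet Ω δ
    · simp [h2, h4, show q.2 ∈ outerStrip Ω δ from ⟨h4, h3⟩]
    · simp [h2, h4, show q.2 ∉ outerStrip Ω δ from fun h => h4 h.1]

/-- Adding the integrand to its swap counts the pairs separated by `Γ` in both orders, which is
twice `symmIntegrand` for almost every pair within the horizon. -/
lemma kernelPairing_symm {n : ℕ} {P : Polygon Plane n} (hu : Continuous u)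
    (huc : HasCompactSupport u) (hv : Continuous v)
    (hvc : HasCompactSupport v) (hk : IsIsotropicKernel σ δ k) :
    kernelPairing k (stripDiffProd (region P) δ (region P) u v (1 / 2) (1 / 2)) =
      kernelPairing k (symmIntegrand P u v) := by
  set Ψ := stripDiffProd (region P) δ (region P) u v (1 / 2) (1 / 2) with hΨ
  have hi : Integrable fun q : Plane × Plane => Ψ q * k (q.2 - q.1) :=
    integrable_indicator_diffProd hk measurableSet_outerStrip
      (volume_outerStrip_ne_top isBounded_region) isOpen_region.measurableSet hu huc hv hvc _ _
  have hi' : Integrable fun q : Plane × Plane => Ψ q.swap * k (q.2 - q.1) := by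
    refine hi.swap.congr (Eventually.of_forall fun q => ?_)
    simp only [Function.comp, Prod.fst_swap, Prod.snd_swap]
    rw [← hk.even (q.1 - q.2), neg_sub]
  have h2 : kernelPairing k (fun q => Ψ q + Ψ q.swap) =
      kernelPairing k (fun q => 2 * symmIntegrand P u v q) := by
    refine kernelPairing_congr hk ?_
    filter_upwards [ae_notMem_frontier (convex_region (P := P))] with q hq hd
    have key : ∀ x y : Plane, y ∉ frontier (region P) → x ∈ region P → ‖y - x‖ ≤ δ →
        (y ∈ outerStrip (region P) δ ↔ y ∉ region P) := by
      intro x y hy hx hxy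
      refine ⟨fun h h' => h.2 (subset_closure h'), fun h => ?_⟩
      refine mem_outerStrip_of_le isOpen_region hk.horizon_pos hx
        (fun h' => hy ⟨h', by rwa [isOpen_region.interior_eq]⟩) ?_
      rwa [dist_comm, dist_eq_norm]
    have hd' : ‖q.1 - q.2‖ ≤ δ := by rwa [norm_sub_rev]
    simp only [hΨ, stripDiffProd, diffProd, symmIntegrand, symmDiffProd, Prod.fst_swap,
      Prod.snd_swap, add_sub_cancel]
    by_cases h1 : q.1 ∈ region P <;> by_cases h2 : q.2 ∈ region P
    · have h3 := (key q.1 q.2 hq.2 h1 hd)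
      have h4 := (key q.2 q.1 hq.1 h2 hd')
      simp [h1, h2, h3, h4, indicator]
    · have h3 := (key q.1 q.2 hq.2 h1 hd)
      simp [h1, h2, h3, indicator]
      ring
    · have h4 := (key q.2 q.1 hq.1 h2 hd')
      simp [h1, h2, h4, indicator]
      ring
    · simp [h1, h2]
  have h3 : kernelPairing k (fun q => Ψ q + Ψ q.swap) =
      kernelPairing k Ψ + kernelPairing k Ψ := by
    conv_rhs => rw [← kernelPairing_swap hk Ψ]
    conv_rhs => arg 1; rw [kernelPairing_swap hk Ψ]
    rw [kernelPairing, kernelPairing, kernelPairing, ← integral_add hi hi']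
    simp_rw [add_mul]
  have h4 : kernelPairing k (fun q => 2 * symmIntegrand P u v q) =
      2 * kernelPairing k (symmIntegrand P u v) := by
    rw [kernelPairing, kernelPairing, ← integral_const_mul]
    simp_rw [mul_assoc]
  linarith

/-- Each of the three pairings approximates the boundary pairing. -/
theorem IsConvexCCW.opSign_mul_kernelPairing_sub_le {n : ℕ} {P : Polygon Plane n}
    (hP : IsConvexCCW P) (hu : ContDiff ℝ 2 u) (huc : HasCompactSupport u)
    (hv : ContDiff ℝ 1 v) (hvc : HasCompactSupport v) (κ : NeumannKind) :
    ∃ C, ∀ (σ δ : ℝ) (k : Plane → ℝ), IsIsotropicKernel σ δ k → δ ≤ 1 →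
      |opSign κ * kernelPairing k (opIntegrand κ (region P) δ u v) - boundaryPairing P σ u v| ≤
        C * (4 * σ * δ) := by
  obtain ⟨C, hC0, hC⟩ := hP.kernelPairing_symmIntegrand_sub_le hu huc hv hvc
  obtain ⟨A, hA0, hA⟩ := exists_volume_outerStrip_le (isOpen_region (P := P)) convex_region
    isBounded_region hP.region_nonempty
  obtain ⟨Lu, hLu⟩ := (hu.of_le one_le_two).lipschitzWith_of_hasCompactSupport huc one_ne_zero
  obtain ⟨Lv, hLv⟩ := hv.lipschitzWith_of_hasCompactSupport hvc one_ne_zero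
  refine ⟨C + Lu * Lv * A, fun σ δ k hk hδ1 => ?_⟩
  have hσ := hk.moment_nonneg
  have hS : ∀ S : Set Plane, ∀ a : ℝ, |a| = 1 / 2 →
      |kernelPairing k (stripDiffProd (region P) δ S u v a (-a))| ≤
        Lu * Lv * A * (4 * σ * δ) / 2 := by
    intro S a ha
    refine (abs_kernelPairing_stripDiffProd_le isBounded_region hk hLu hLv S a).trans ?_
    rw [ha]
    calc (1 / 2 : ℝ) * Lu * Lv * (volume.real (outerStrip (region P) δ) * (4 * σ)) ≤
        1 / 2 * Lu * Lv * ((A * δ) * (4 * σ)) := by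
          gcongr
          exact hA δ hk.horizon_pos hδ1
      _ = _ := by ring
  have hadd := kernelPairing_stripDiffProd_add (isBounded_region (P := P)) hu.continuous huc
    hv.continuous hvc hk (isOpen_region (P := P)).measurableSet
  have hsym := kernelPairing_symm (P := P) hu.continuous huc hv.continuous hvc hk
  have hm := hC σ δ k hk
  have h1 := hS (region P) (1 / 2) (by norm_num)
  have h2 := hS (region P) (-(1 / 2)) (by norm_num)
  -- The weights `(1, 0)` and `(0, 1)` differ from `(1/2, 1/2)` by `±(1/2, -1/2)`, whose
  -- contribution `hS` bounds.
  have hadd1 := hadd (1 / 2) (-(1 / 2)) (1 / 2) (1 / 2)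
  have hadd2 := hadd (-(1 / 2)) (- -(1 / 2)) (1 / 2) (1 / 2)
  rw [show (1 / 2 : ℝ) + 1 / 2 = 1 by norm_num, neg_add_cancel] at hadd1
  rw [show - -(1 / 2 : ℝ) + 1 / 2 = 1 by norm_num, neg_add_cancel] at hadd2
  have hpos : 0 ≤ Lu * Lv * A * (4 * σ * δ) := by
    have := hk.horizon_pos.le
    positivity
  rw [abs_le] at hm h1 h2 ⊢
  cases κ with
  | plus =>
    rw [kernelPairing_plus hk, opSign, one_mul]
    constructor <;> linarith
  | minus =>
    rw [opSign, neg_one_mul, kernelPairing_minus hk]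
    constructor <;> linarith
  | star =>
    rw [kernelPairing_star isOpen_region convex_region isBounded_region hu.continuous huc
      hv.continuous hvc hk, kernelPairing_outerStrip isBounded_region hu.continuous huc
      hv.continuous hvc hk, opSign, one_mul]
    have h3 := abs_le.1 (hS (outerStrip (region P) δ) (1 / 2) (by norm_num))
    constructor <;> linarith

end Comparison

open scoped ContDiff Manifold

/-! ### Localization near the boundary -/

section Localization

/-- A full thickening with `χ = 1` preserves boundary derivatives and leaves room for the horizon.
-/
lemma exists_contDiff_cutoff {K U : Set Plane} (hK : IsCompact K) (hU : IsOpen U) (hKU : K ⊆ U) :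
    ∃ (χ : Plane → ℝ) (r : ℝ), ContDiff ℝ ∞ χ ∧ HasCompactSupport χ ∧ tsupport χ ⊆ U ∧ 0 < r ∧
      ∀ x ∈ Metric.cthickening r K, χ x = 1 := by
  obtain ⟨ε, hε, hsub⟩ := hK.exists_cthickening_subset_open hU hKU
  obtain ⟨χ, hχ, -, hsupp, h1⟩ := exists_contMDiff_support_eq_eq_one_iff 𝓘(ℝ, Plane) (n := ⊤)
    (Metric.isOpen_thickening (δ := ε) (E := K))
    (Metric.isClosed_cthickening (δ := ε / 2) (E := K))
    (Metric.cthickening_subset_thickening' hε (by linarith) K)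
  have ht : tsupport χ ⊆ Metric.cthickening ε K := by
    rw [tsupport, hsupp]
    exact Metric.closure_thickening_subset_cthickening ε K
  exact ⟨χ, ε / 2, hχ.contDiff, hK.cthickening.of_isClosed_subset (isClosed_tsupport χ) ht,
    ht.trans hsub, by positivity, fun x hx => (h1 x).1 hx⟩

lemma contDiff_cutoff_mul {U : Set Plane} (hU : IsOpen U) {χ u : Plane → ℝ} {m : WithTop ℕ∞}
    (hχ : ContDiff ℝ m χ) (hχU : tsupport χ ⊆ U) (hu : ContDiffOn ℝ m u U) :
    ContDiff ℝ m fun x => χ x * u x := by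
  refine contDiff_iff_contDiffAt.2 fun x => ?_
  by_cases hx : x ∈ tsupport χ
  · exact hχ.contDiffAt.mul (hu.contDiffAt (hU.mem_nhds (hχU hx)))
  · have h0 : (fun x => χ x * u x) =ᶠ[𝓝 x] fun _ => 0 := by
      filter_upwards [(isClosed_tsupport χ).isOpen_compl.mem_nhds hx] with y hy
      rw [image_eq_zero_of_notMem_tsupport hy, zero_mul]
    exact contDiffAt_const.congr_of_eventuallyEq h0

variable {n : ℕ} {P : Polygon Plane n}

lemma isCompact_boundary : IsCompact (P.boundary ℝ) := by
  rw [Polygon.boundary]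
  refine isCompact_iUnion fun i => ?_
  rw [Polygon.edgeSet_eq_image_edgePath]
  exact isCompact_Icc.image (continuous_edgePath i)

lemma boundaryPairing_congr {u v u' v' : Plane → ℝ} (σ : ℝ)
    (hu : ∀ x ∈ P.boundary ℝ, u =ᶠ[𝓝 x] u') (hv : ∀ x ∈ P.boundary ℝ, v x = v' x) :
    boundaryPairing P σ u v = boundaryPairing P σ u' v' := by
  rw [boundaryPairing, boundaryPairing]
  refine Finset.sum_congr rfl fun i _ => intervalIntegral.integral_congr fun t ht => ?_
  rw [uIcc_of_le zero_le_one] at ht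
  have hm : P.edgePath ℝ i t ∈ P.boundary ℝ := by
    rw [Polygon.boundary, mem_iUnion]
    refine ⟨i, ?_⟩
    rw [Polygon.edgeSet_eq_image_edgePath]
    exact ⟨t, ht, rfl⟩
  rw [(hu _ hm).fderiv_eq, hv _ hm]

lemma measurableSet_opDomain {Ω : Set Plane} (ho : IsOpen Ω) (κ : NeumannKind) (δ : ℝ) :
    MeasurableSet (opDomain κ Ω δ) := by
  cases κ
  exacts [measurableSet_innerStrip ho, measurableSet_outerStrip, measurableSet_outerStrip]

lemma measurableSet_opRange {Ω : Set Plane} (ho : IsOpen Ω) (κ : NeumannKind) (δ : ℝ) :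
    MeasurableSet (opRange κ Ω δ) := by
  cases κ
  exacts [measurableSet_outerStrip, measurableSet_innerStrip ho, measurableSet_outerSet]

lemma volume_opDomain_ne_top {Ω : Set Plane} (hb : Bornology.IsBounded Ω) (κ : NeumannKind)
    (δ : ℝ) : volume (opDomain κ Ω δ) ≠ ⊤ := by
  cases κ
  exacts [(hb.subset sdiff_subset).measure_lt_top.ne, volume_outerStrip_ne_top hb,
    volume_outerStrip_ne_top hb]

lemma exists_frontier_of_mem_opDomain {Ω : Set Plane} {κ : NeumannKind} {δ : ℝ} {x : Plane}
    (hx : x ∈ opDomain κ Ω δ) (hδ : 0 < δ) : ∃ p ∈ frontier Ω, dist x p < δ := by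
  cases κ
  exacts [exists_frontier_of_mem_innerStrip hx hδ, exists_frontier_of_mem_outerStrip hx hδ,
    exists_frontier_of_mem_outerStrip hx hδ]

/-- The pairing in terms of globally smooth functions that agree with `u` and `v` near the
boundary. -/
lemma pairingConverges_and_neumannPairing_eq {Ω : Set Plane} (ho : IsOpen Ω)
    (hb : Bornology.IsBounded Ω) {σ δ : ℝ} {g : ℝ → ℝ} (hg : IsKernelProfile σ δ g)
    (κ : NeumannKind) {u v u' v' : Plane → ℝ}
    (hu : Continuous u') (huc : HasCompactSupport u') (hv : Continuous v')
    (hvc : HasCompactSupport v')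
    (hloc : ∀ x ∈ opDomain κ Ω δ, ∀ y, dist x y ≤ δ → u y = u' y ∧ v y = v' y) :
    PairingConverges κ Ω δ g u v ∧ neumannPairing κ Ω δ g u v =
      opSign κ * kernelPairing (fun z => g ‖z‖) (opIntegrand κ Ω δ u' v') := by
  have hD := measurableSet_opDomain ho κ δ
  have hR := measurableSet_opRange ho κ δ
  have hI : Integrable fun q : Plane × Plane => opIntegrand κ Ω δ u' v' q * g ‖q.2 - q.1‖ :=
    integrable_indicator_diffProd hg.isIsotropicKernel hD (volume_opDomain_ne_top hb κ δ) hR hu huc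
      hv hvc 1 0
  have heq : ∀ q : Plane × Plane, (opDomain κ Ω δ ×ˢ opRange κ Ω δ).indicator
      (fun z => (u z.1 - u z.2) * g (dist z.1 z.2) * v z.1) q =
        opIntegrand κ Ω δ u' v' q * g ‖q.2 - q.1‖ := by
    intro q
    by_cases h1 : q.1 ∈ opDomain κ Ω δ
    · by_cases h2 : q.2 ∈ opRange κ Ω δ
      · rw [indicator_of_mem (mk_mem_prod h1 h2), ← dist_eq_norm, dist_comm q.2]
        simp only [opIntegrand, diffProd, indicator_of_mem h1, indicator_of_mem h2, Pi.one_apply]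
        by_cases hd : δ < dist q.1 q.2
        · simp [hg.eq_zero _ hd]
        · obtain ⟨e1, e2⟩ := hloc q.1 h1 q.1 (by simpa using hg.horizon_pos.le)
          obtain ⟨e3, -⟩ := hloc q.1 h1 q.2 (not_lt.1 hd)
          rw [e1, e2, e3]
          ring
      · rw [indicator_of_notMem fun h => h2 h.2]
        simp [opIntegrand, h2]
    · rw [indicator_of_notMem fun h => h1 h.1]
      simp [opIntegrand, h1]
  have hconv : PairingConverges κ Ω δ g u v := by
    rw [PairingConverges, Measure.prod_restrict, ← Measure.volume_eq_prod, ← IntegrableOn,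
      ← integrable_indicator_iff (hD.prod hR)]
    simp_rw [funext heq]
    exact hI
  refine ⟨hconv, ?_⟩
  have h1 : ∀ x, neumannOp κ Ω δ g u x * v x = opSign κ *
      ∫ y in opRange κ Ω δ, (u x - u y) * g (dist x y) * v x := fun x => by
    rw [neumannOp, integral_mul_const, mul_assoc]
  rw [neumannPairing]
  simp_rw [h1]
  rw [integral_const_mul, integral_integral (f := fun x y => (u x - u y) * g (dist x y) * v x)
    hconv, Measure.prod_restrict, ← integral_indicator (hD.prod hR), ← Measure.volume_eq_prod]
  simp_rw [heq]
  rfl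

end Localization

/-- The pairing of a nonlocal Neumann operator converges, as the horizon shrinks, to the boundary
pairing with the local normal derivative, at first order. -/
theorem exists_abs_neumannPairing_sub_boundaryPairing_le {n : ℕ} (P : Polygon Plane n)
    (hP : IsConvexCCW P) (σ : ℝ)
    (U : Set Plane) (hU : IsOpen U) (hΓ : P.boundary ℝ ⊆ U)
    (u v : Plane → ℝ) (hu : ContDiffOn ℝ 2 u U) (hv : ContDiffOn ℝ 1 v U)
    (k : NeumannKind) :
    ∃ C δ₀ : ℝ, 0 < δ₀ ∧ ∀ (δ : ℝ) (g : ℝ → ℝ), δ < δ₀ →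
      IsKernelProfile σ δ g →
      MemSN k (region P) δ g u →
        PairingConverges k (region P) δ g u v ∧
        |neumannPairing k (region P) δ g u v -
          boundaryPairing P σ u v| ≤ C * δ := by
  obtain ⟨χ, r, hχ, hχc, hχU, hr, hχ1⟩ := exists_contDiff_cutoff isCompact_boundary hU hΓ
  have hu' := contDiff_cutoff_mul hU (contDiff_infty.1 hχ 2) hχU hu
  have hv' := contDiff_cutoff_mul hU (contDiff_infty.1 hχ 1) hχU hv
  have huc : HasCompactSupport fun x => χ x * u x := hχc.mul_right
  have hvc : HasCompactSupport fun x => χ x * v x := hχc.mul_right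
  obtain ⟨C, hC⟩ := hP.opSign_mul_kernelPairing_sub_le hu' huc hv' hvc k
  -- `δ ≤ 1` serves the strip area. `2 δ < r` is needed because `y` is within `δ` of `x`, itself
  -- within `δ` of `Γ`.
  refine ⟨C * (4 * σ), min 1 (r / 2), by positivity, fun δ g hδ hg _ => ?_⟩
  have hδ0 := hg.horizon_pos
  obtain ⟨hδ1, hδr⟩ := lt_min_iff.1 hδ
  have hloc : ∀ x ∈ opDomain k (region P) δ, ∀ y, dist x y ≤ δ →
      u y = χ y * u y ∧ v y = χ y * v y := by
    intro x hx y hxy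
    obtain ⟨p, hp, hxp⟩ := exists_frontier_of_mem_opDomain hx hδ0
    have hy : χ y = 1 := hχ1 y <| Metric.mem_cthickening_of_dist_le y p r _
      (hP.frontier_subset hp) (by linarith [dist_triangle y x p, dist_comm x y])
    simp [hy]
  obtain ⟨hconv, hval⟩ := pairingConverges_and_neumannPairing_eq isOpen_region isBounded_region hg k
    hu'.continuous huc hv'.continuous hvc hloc
  refine ⟨hconv, ?_⟩
  have hbdry : boundaryPairing P σ u v =
      boundaryPairing P σ (fun x => χ x * u x) (fun x => χ x * v x) := by
    refine boundaryPairing_congr σ (fun x hx => ?_) fun x hx => ?_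
    · filter_upwards [Metric.isOpen_thickening.mem_nhds (Metric.self_subset_thickening hr _ hx)]
        with y hy
      rw [hχ1 y (Metric.thickening_subset_cthickening _ _ hy), one_mul]
    · rw [hχ1 x (Metric.self_subset_cthickening _ hx), one_mul]
  rw [hval, hbdry]
  refine (hC σ δ _ hg.isIsotropicKernel hδ1.le).trans (le_of_eq ?_)
  ring

end NonlocalNeumann

theorem theorem2p3 {n : ℕ} (P : Polygon NonlocalNeumann.Plane n)
    (hP : NonlocalNeumann.IsConvexCCW P) (σ : ℝ)
    (U : Set NonlocalNeumann.Plane) (hU : IsOpen U) (hΓ : P.boundary ℝ ⊆ U)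
    (u v : NonlocalNeumann.Plane → ℝ) (hu : ContDiffOn ℝ 2 u U) (hv : ContDiffOn ℝ 1 v U)
    (k : NonlocalNeumann.NeumannKind) :
    ∃ C δ₀ : ℝ, 0 < δ₀ ∧ ∀ (δ : ℝ) (g : ℝ → ℝ), δ < δ₀ →
      NonlocalNeumann.IsKernelProfile σ δ g →
      NonlocalNeumann.MemSN k (NonlocalNeumann.region P) δ g u →
        NonlocalNeumann.PairingConverges k (NonlocalNeumann.region P) δ g u v ∧
        |NonlocalNeumann.neumannPairing k (NonlocalNeumann.region P) δ g u v -
          NonlocalNeumann.boundaryPairing P σ u v| ≤ C * δ :=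
  NonlocalNeumann.exists_abs_neumannPairing_sub_boundaryPairing_le P hP σ U hU hΓ u v hu hv k
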